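/- **Setting.** Let $d,n\in\mathbb N$, let $A_1,\dots,A_d\in\mathbb R^{n\times n}$ be symmetric, $E\in\mathbb R^{n\times n}$ skew-symmetric, and $T:\mathbb R^n\times\mathbb R^n\times\mathbb R^n\to\mathbb R^n$ trilinear; the trilinear extension to $\mathbb C^n$ is also denoted by $T$, and $|T(a,b,c)|_2\le C_T|a|_2|b|_2|c|_2$ for all $a,b,c\in\mathbb C^n$. Put $A(\beta)=\sum_\ell\beta_\ell A_\ell$ and $L(\alpha,\beta)=-\alpha I+A(\beta)-\mathrm iE$ for $\alpha\in\mathbb R$, $\beta\in\mathbb R^d$. Let $\kappa\in\mathbb R^d\setminus\{0\}$ and $\omega\in\mathbb R$. With $\widehat f(k)=(2\pi)^{-d/2}\int f(x)e^{-\mathrm ik\cdot x}\,dx$, let $W$ be the space of $f:\mathbb R^d\to\mathbb C^n$ with $\widehat f\in L^1$, $\|f\|_W=\int|\widehat f(k)|_2\,dk$, and let $W^1$ be the space of $f\in W$ with $\partial_\ell f\in W$ for all $\ell$, $\|f\|_{W^1}=\|f\|_W+\sum_\ell\|\partial_\ell f\|_W$. Let $p\in W^1$ and $t_{\rm end}>0$.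 For $\varepsilon\in(0,1]$ let $u=(u_1,u_3)$, $u_j\in C^1([0,t_{\rm end}/\varepsilon],W)\cap C([0,t_{\rm end}/\varepsilon],W^1)$, be a classical solution of $$\partial_t u_j+\tfrac{\mathrm i}{\varepsilon}L(j\omega,j\kappa)u_j+\sum_{\ell=1}^dA_\ell\partial_\ell u_j=\varepsilon\sum_{\substack{j_1,j_2,j_3\in\{\pm1,\pm3\}\\ j_1+j_2+j_3=j}}T(u_{j_1},u_{j_2},u_{j_3}),\qquad j\in\{1,3\},\ t\in(0,t_{\rm end}/\varepsilon],$$ where $u_{-j}=\overline{u_j}$, with $u_1(0)=p$ and $u_3(0)=0$. **Assumption 1.** $\ker L(\omega,\kappa)$ is one-dimensional; $p(x)\in\ker L(\omega,\kappa)$ for all $x$; $L(3\omega,3\kappa)$ and $L(5\omega,5\kappa)$ are invertible. **Assumption 2.** There are $\lambda_\ell:\mathbb R^d\to\mathbb R$ and $\psi_\ell:\mathbb R^d\to\mathbb C^n$, $\ell=1,\dots,n$, such that for every $\beta$ the vectors $\psi_1(\beta),\dots,\psi_n(\beta)$ are orthonormal with $L(0,\beta)\psi_\ell(\beta)=\lambda_\ell(\beta)\psi_\ell(\beta)$;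 all $\lambda_\ell$ and $\psi_\ell$ are $C^\infty$ on $\mathbb R^d\setminus\{0\}$; and $|\lambda_\ell(\widetilde\beta)-\lambda_\ell(\beta)|\le K|\widetilde\beta-\beta|_1$ for all $\beta,\widetilde\beta\in\mathbb R^d$. Number the eigenvalues such that $\lambda_1(\kappa)=\omega$. For $j\in\{1,3\}$ let $\Lambda_j(\theta)$ be the diagonal matrix with entries $\lambda_{j\ell}(\theta)=\lambda_\ell(j\kappa+\theta)-j\omega$, let $\Psi_j(\theta)$ be the unitary matrix with columns $\psi_\ell(j\kappa+\theta)$, and define $$z_j(t,k)=S_{j,\varepsilon}(t,k)\,\widehat u_j(t,k),\qquad S_{j,\varepsilon}(t,k)=\exp\big(\tfrac{\mathrm it}{\varepsilon}\Lambda_j(\varepsilon k)\big)\Psi_j(\varepsilon k)^*.$$ Let $P(w_1,\dots,w_n)^T=(w_1,0,\dots,0)^T$, $P^\perp=I-P$, and $\mathcal P_\varepsilon(k)=\psi_1(\kappa+\varepsilon k)\psi_1(\kappa+\varepsilon k)^*$. **Proposition 1.** Under Assumptions 1 and 2, for every sufficiently large $r>0$ there is $t_\star\in(0,t_{\rm end}]$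 such that for all $\varepsilon\in(0,1]$ and all $t\in[0,t_\star/\varepsilon]$ $$2\|Pz_1(t)\|_{L^1}+\tfrac2\varepsilon\|P^\perp z_1(t)\|_{L^1}+\tfrac2\varepsilon\|z_3(t)\|_{L^1}\le r,$$ and therefore also $\|(I-\mathcal P_\varepsilon)\widehat u_1(t)\|_{L^1}\le\tfrac r2\varepsilon$ and $\|u_3(t)\|_W\le\tfrac r2\varepsilon$. Besides $d$ and $n$, the threshold for $r$ depends only on $t_{\rm end}$ and on upper bounds for $\|p\|_{W^1}$, for $C_T$, for the inverses $|\lambda_{j\ell}(0)|^{-1}$ of the nonzero eigenvalues of $\Lambda_1(0)$ and $\Lambda_3(0)$, and for the Lipschitz constant $K$; $t_\star$ depends only on these and on $r$. In particular neither depends on $\varepsilon$. -/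

import Mathlib

open MeasureTheory Set Complex
open scoped ENNReal

noncomputable section

/-- `ℝ^d`: physical space and Fourier space. -/
abbrev Rd (d : ℕ) := EuclideanSpace ℝ (Fin d)

/-- `ℂ^n` with the Euclidean norm `|·|₂`. -/
abbrev Cn (n : ℕ) := EuclideanSpace ℂ (Fin n)

/-- The coefficients of `∂ₜu + A(∂)u + ε⁻¹ E u = ε T(u,u,u)`: symmetric `A₁, …, A_d`,
skew-symmetric `E`, and a real trilinear map `T`. -/
structure HypSystem (d n : ℕ) where
  A : Fin d → Matrix (Fin n) (Fin n) ℝ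
  A_symm : ∀ l, (A l).IsSymm
  E : Matrix (Fin n) (Fin n) ℝ
  E_skew : E.transpose = -E
  T : EuclideanSpace ℝ (Fin n) →ₗ[ℝ] EuclideanSpace ℝ (Fin n) →ₗ[ℝ]
    EuclideanSpace ℝ (Fin n) →ₗ[ℝ] EuclideanSpace ℝ (Fin n)

namespace HypSystem

variable {d n : ℕ} (Q : HypSystem d n)

/-- `L(α, β) = -α I + ∑ β_l A_l - i E`. -/
def L (α : ℝ) (β : Rd d) : Matrix (Fin n) (Fin n) ℂ :=
  -(α : ℂ) • (1 : Matrix (Fin n) (Fin n) ℂ)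
    + ∑ l, (β l : ℂ) • (Q.A l).map Complex.ofReal
    - Complex.I • Q.E.map Complex.ofReal

/-- The trilinear extension of `T` to `ℂ^n`: `∑ aᵢ bⱼ cₖ T(eᵢ, eⱼ, eₖ)`. -/
def TC (a b c : Cn n) : Cn n :=
  WithLp.toLp 2 fun m => ∑ i, ∑ j, ∑ k, a i * b j * c k *
    ((Q.T (EuclideanSpace.single i 1) (EuclideanSpace.single j 1)
      (EuclideanSpace.single k 1) m : ℝ) : ℂ)

end HypSystem

/-- The Wiener algebra `W` of `ℂ^n`-valued functions on `ℝ^d` whose Fourier transform is in `L¹`.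
An element `f` is stored as its Fourier transform `f̂ ∈ L¹(ℝ^d, ℂ^n)`, so that the norm of this
type is `‖f‖_W = ‖f̂‖_{L¹}`; the function `f` itself is `Wiener.eval f`. -/
abbrev Wiener (d n : ℕ) : Type := Lp (Cn n) 1 (volume : Measure (Rd d))

namespace Wiener

variable {d n : ℕ}

/-- The value `f(x) = (2π)^{-d/2} ∫ f̂(k) e^{i k·x} dk`. -/
def eval (f : Wiener d n) (x : Rd d) : Cn n :=
  ((2 * Real.pi) ^ (-(d : ℝ) / 2) : ℝ) •
    ∫ k : Rd d, Complex.exp (Complex.I * ((inner ℝ k x : ℝ) : ℂ)) • f k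

/-- `g = ∂_l f`, where `f, g ∈ W`. -/
def IsPartial (l : Fin d) (f g : Wiener d n) : Prop :=
  ∀ x, HasLineDerivAt ℝ (eval f) (eval g x) x (EuclideanSpace.single l 1)

/-- `f ∈ W¹`: all first partial derivatives of `f ∈ W` are in `W`. -/
def MemW1 (f : Wiener d n) : Prop := ∀ l, ∃ g : Wiener d n, IsPartial l f g

open Classical in
/-- `∂_l f` as an element of `W` (and `0` if `∂_l f` is not in `W`). -/
def partialD (l : Fin d) (f : Wiener d n) : Wiener d n :=
  if h : ∃ g : Wiener d n, IsPartial l f g then h.choose else 0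

/-- `‖f‖_{W¹} = ‖f‖_W + ∑ ‖∂_l f‖_W`, for `f ∈ W¹`. -/
def normW1 (f : Wiener d n) : ℝ := ‖f‖ + ∑ l, ‖partialD l f‖

end Wiener

/-- The index set `{±1, ±3}`. -/
def harmonics : Finset ℤ := {1, -1, 3, -3}

/-- All `(j₁, j₂, j₃)` with entries in `{±1, ±3}` and `j₁ + j₂ + j₃ = j`. -/
def triads (j : ℤ) : Finset (ℤ × ℤ × ℤ) :=
  (harmonics ×ˢ harmonics ×ˢ harmonics).filter fun J => J.1 + J.2.1 + J.2.2 = j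

/-- Entrywise complex conjugation. -/
def conjVec {n : ℕ} (v : Cn n) : Cn n := WithLp.toLp 2 fun m => starRingEnd ℂ (v m)

/-- `u_j(x)` for `j ∈ {±1, ±3}`, with `u_{-j} = conj u_j`. -/
def modeVal {d n : ℕ} (u₁ u₃ : Wiener d n) (j : ℤ) (x : Rd d) : Cn n :=
  if j = 1 then Wiener.eval u₁ x
  else if j = 3 then Wiener.eval u₃ x
  else if j = -1 then conjVec (Wiener.eval u₁ x)
  else if j = -3 then conjVec (Wiener.eval u₃ x)
  else 0

section Solution

variable {d n : ℕ}

/-- `∂ₜu_j + (i/ε) L(jω, jκ) u_j + A(∂) u_j = ε ∑_{j₁+j₂+j₃=j} T(u_{j₁}, u_{j₂}, u_{j₃})` at `x`,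
where `w` is `u_j` and `w'` is `∂ₜu_j`, at a fixed time. -/
def EnvelopeEq (Q : HypSystem d n) (κ : Rd d) (ω ε : ℝ) (u₁ u₃ : Wiener d n)
    (j : ℤ) (w w' : Wiener d n) (x : Rd d) : Prop :=
  Wiener.eval w' x
    + (Complex.I / (ε : ℂ)) • Matrix.toEuclideanLin (Q.L (j * ω) ((j : ℝ) • κ)) (Wiener.eval w x)
    + ∑ l, Matrix.toEuclideanLin ((Q.A l).map Complex.ofReal)
        (lineDeriv ℝ (Wiener.eval w) x (EuclideanSpace.single l 1))
  = (ε : ℂ) • ∑ J ∈ triads j,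
      Q.TC (modeVal u₁ u₃ J.1 x) (modeVal u₁ u₃ J.2.1 x) (modeVal u₁ u₃ J.2.2 x)

/-- `w ∈ C¹([0,τ], W) ∩ C([0,τ], W¹)`. -/
structure ClassicalRegularity (τ : ℝ) (w : ℝ → Wiener d n) : Prop where
  contDiffOn : ContDiffOn ℝ 1 w (Icc 0 τ)
  memW1 : ∀ t ∈ Icc 0 τ, Wiener.MemW1 (w t)
  continuousOn_partial : ∀ l, ContinuousOn (fun t => Wiener.partialD l (w t)) (Icc 0 τ)

/-- `(u₁, u₃)` is a classical solution on `[0, τ]` of the envelope system with initial data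
`u₁(0) = p`, `u₃(0) = 0`. -/
structure IsClassicalSolution (Q : HypSystem d n) (κ : Rd d) (ω ε τ : ℝ) (p : Wiener d n)
    (u₁ u₃ : ℝ → Wiener d n) : Prop where
  regular₁ : ClassicalRegularity τ u₁
  regular₃ : ClassicalRegularity τ u₃
  eq₁ : ∀ t ∈ Ioc 0 τ, ∀ x,
    EnvelopeEq Q κ ω ε (u₁ t) (u₃ t) 1 (u₁ t) (derivWithin u₁ (Icc 0 τ) t) x
  eq₃ : ∀ t ∈ Ioc 0 τ, ∀ x,
    EnvelopeEq Q κ ω ε (u₁ t) (u₃ t) 3 (u₃ t) (derivWithin u₃ (Icc 0 τ) t) x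
  init₁ : u₁ 0 = p
  init₃ : u₃ 0 = 0

/-- One-dimensional kernel of `L(ω, κ)`, polarized initial data, and invertibility of
`L(3ω, 3κ)` and `L(5ω, 5κ)`. -/
structure PolarizationAssumption (Q : HypSystem d n) (κ : Rd d) (ω : ℝ) (p : Wiener d n) :
    Prop where
  ker_dim : Module.finrank ℂ (LinearMap.ker (Matrix.toEuclideanLin (Q.L ω κ))) = 1
  polarized : ∀ x, Wiener.eval p x ∈ LinearMap.ker (Matrix.toEuclideanLin (Q.L ω κ))
  invertible₃ : IsUnit (Q.L (3 * ω) ((3 : ℝ) • κ))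
  invertible₅ : IsUnit (Q.L (5 * ω) ((5 : ℝ) • κ))

/-- `L(0, β) ψ_ℓ(β) = λ_ℓ(β) ψ_ℓ(β)` is an orthonormal eigendecomposition for every `β` which is
smooth away from `β = 0`, and the eigenvalues are globally Lipschitz with constant `K` with respect
to `|·|₁`. -/
structure SmoothEigendecomposition (Q : HypSystem d n) (K : ℝ)
    (lam : Fin n → Rd d → ℝ) (psi : Fin n → Rd d → Cn n) : Prop where
  eigen : ∀ ℓ β, Matrix.toEuclideanLin (Q.L 0 β) (psi ℓ β) = (lam ℓ β : ℂ) • psi ℓ β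
  orthonormal : ∀ β, Orthonormal ℂ fun ℓ => psi ℓ β
  smooth_lam : ∀ ℓ, ContDiffOn ℝ ((⊤ : ℕ∞) : WithTop ℕ∞) (lam ℓ) {0}ᶜ
  smooth_psi : ∀ ℓ, ContDiffOn ℝ ((⊤ : ℕ∞) : WithTop ℕ∞) (psi ℓ) {0}ᶜ
  lipschitz : ∀ ℓ β β', |lam ℓ β' - lam ℓ β| ≤ K * ∑ l, |β' l - β l|

/-- The eigenvalue `λ_{jℓ}(θ) = λ_ℓ(jκ + θ) - jω` of `L_j(θ) = L(jω, jκ + θ)`. -/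
def lamJ (κ : Rd d) (ω : ℝ) (lam : Fin n → Rd d → ℝ) (j : ℕ) (ℓ : Fin n) (θ : Rd d) : ℝ :=
  lam ℓ ((j : ℝ) • κ + θ) - j * ω

/-- The unitary matrix `Ψ_j(θ)`, with columns the eigenvectors `ψ_ℓ(jκ + θ)` of `L_j(θ)`. -/
def PsiJ (κ : Rd d) (psi : Fin n → Rd d → Cn n) (j : ℕ) (θ : Rd d) :
    Matrix (Fin n) (Fin n) ℂ :=
  Matrix.of fun m ℓ => psi ℓ ((j : ℝ) • κ + θ) m

/-- `S_{j,ε}(t,k) = exp((it/ε) Λ_j(εk)) Ψ_j(εk)*`. -/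
def SJ (κ : Rd d) (ω : ℝ) (lam : Fin n → Rd d → ℝ) (psi : Fin n → Rd d → Cn n)
    (j : ℕ) (ε t : ℝ) (k : Rd d) : Matrix (Fin n) (Fin n) ℂ :=
  Matrix.diagonal (fun ℓ => Complex.exp (Complex.I * (t / ε * lamJ κ ω lam j ℓ (ε • k) : ℝ)))
    * (PsiJ κ psi j (ε • k)).conjTranspose

/-- The transformed variable `z_j(t,k) = S_{j,ε}(t,k) û_j(t,k)`, where `w = u_j(t)`. -/
def zJ (κ : Rd d) (ω : ℝ) (lam : Fin n → Rd d → ℝ) (psi : Fin n → Rd d → Cn n)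
    (j : ℕ) (ε t : ℝ) (w : Wiener d n) (k : Rd d) : Cn n :=
  Matrix.toEuclideanLin (SJ κ ω lam psi j ε t k) (w k)

/-- The projection `P` of `ℂ^n` that keeps the entry with index `ℓ₁` and annihilates the others. -/
def coordProj (ℓ₁ : Fin n) (w : Cn n) : Cn n := EuclideanSpace.single ℓ₁ (w ℓ₁)

/-- The scaled norm `2‖P y₁‖_{L¹} + (2/ε)‖P^⊥ y₁‖_{L¹} + (2/ε)‖y₃‖_{L¹}`. -/
def scaledNorm (ℓ₁ : Fin n) (ε : ℝ) (y₁ y₃ : Rd d → Cn n) : ℝ≥0∞ :=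
  2 * eLpNorm (fun k => coordProj ℓ₁ (y₁ k)) 1 volume
    + ENNReal.ofReal (2 / ε) * eLpNorm (fun k => y₁ k - coordProj ℓ₁ (y₁ k)) 1 volume
    + ENNReal.ofReal (2 / ε) * eLpNorm y₃ 1 volume

/-- `𝒫_ε(k) û(k) = ψ_{11}(εk) ψ_{11}(εk)* û(k)`, the orthogonal projection onto the distinguished
eigenspace of `L₁(εk)`. -/
def eigProj (κ : Rd d) (psi : Fin n → Rd d → Cn n) (ℓ₁ : Fin n) (ε : ℝ)
    (w : Rd d → Cn n) (k : Rd d) : Cn n :=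
  (inner ℂ (psi ℓ₁ (κ + ε • k)) (w k) : ℂ) • psi ℓ₁ (κ + ε • k)

end Solution

end

/-!
In Fourier space the linear part of the equation for `u_j` is generated by the symmetric matrices
`ε⁻¹ L(jω, jκ + εk)`, so `L¹` norms of `û_j` and of its derivatives grow only through the forcing of
size `ε`, and a bootstrap bounds `u₁` and `u₃` in `W¹` up to a time `t⋆/ε`.

The components along `ψ_ℓ(jκ + εk)` with `λ_{jℓ}(0) ≠ 0` oscillate with a frequency of size `ε⁻¹`,
and an integration by parts in time gains a factor `ε`: if `w` is the mode, `N` its cubic term, `Π`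
the projection onto these components and `R` their division by `λ_{jℓ}(0)`, the forcing of
`Π w + i ε² R N` no longer contains `N` at order `ε`. What must be controlled is `ε² ∂ₜN`. Replacing
`N` by its value at `(𝒫_ε u₁, 0)` costs a multiple of the very quantity `‖(I - 𝒫_ε) û₁‖ + ‖û₃‖` to
be estimated, and the time derivative of `𝒫_ε û₁` is `O(1)`, because the eigenvalue
`λ₁(κ + εk) - ω` vanishes at `k = 0` and is Lipschitz. The polarization of `p` makes this quantity
`O(ε)` initially, and a second bootstrap keeps it `O(ε)`. Since `S_{j,ε}` is unitary, it equals
`‖P^⊥ z₁‖ + ‖z₃‖`.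
-/

/-! ### Growth estimates in time -/

section Growth

open Filter Topology

theorem lt_of_bootstrap {X : ℝ → ℝ} {τ B : ℝ} (hX : ContinuousOn X (Icc 0 τ)) (h0 : X 0 < B)
    (h : ∀ t ∈ Icc 0 τ, (∀ s ∈ Icc 0 t, X s ≤ B) → X t < B) : ∀ t ∈ Icc 0 τ, X t < B := by
  by_contra! hcon
  obtain ⟨t, ht, hBt⟩ := hcon
  have hcross : ∀ s ∈ Icc 0 τ, B ≤ X s → ∃ r ∈ Icc 0 s, X r = B := fun s hs hBs =>
    intermediate_value_Icc hs.1 (hX.mono (Icc_subset_Icc_right hs.2)) ⟨h0.le, hBs⟩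
  let S := Icc 0 τ ∩ X ⁻¹' {B}
  have hS : IsClosed S := hX.preimage_isClosed_of_isClosed isClosed_Icc isClosed_singleton
  have hbdd : BddBelow S := ⟨0, fun t ht => ht.1.1⟩
  obtain ⟨r, hr, hXr⟩ := hcross t ht hBt
  have hmem := hS.csInf_mem ⟨r, ⟨hr.1, hr.2.trans ht.2⟩, hXr⟩ hbdd
  refine (h _ hmem.1 fun s hs => ?_).ne hmem.2
  rcases hs.2.lt_or_eq with hlt | rfl
  · by_contra! hBs
    have hsτ : s ∈ Icc 0 τ := ⟨hs.1, hs.2.trans hmem.1.2⟩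
    obtain ⟨q, hq, hXq⟩ := hcross s hsτ hBs.le
    have := csInf_le hbdd (show q ∈ S from ⟨⟨hq.1, hq.2.trans hsτ.2⟩, hXq⟩)
    exact absurd (this.trans hq.2) (not_le.2 hlt)
  · exact hmem.2.le

theorem exists_mem_Ioc_add_mul_lt {τ a b c a' b' c' : ℝ} (hτ : 0 < τ) (h : a < c) (h' : a' < c') :
    ∃ σ ∈ Ioc 0 τ, a + b * σ < c ∧ a' + b' * σ < c' := by
  have hlim : ∀ {a b c : ℝ}, a < c → ∀ᶠ σ in 𝓝[>] (0 : ℝ), a + b * σ < c :=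
    fun {a b c} h => nhdsWithin_le_nhds (ContinuousAt.eventually_lt
      (by fun_prop) continuousAt_const (by simpa using h))
  obtain ⟨σ, hlt, hlt', hσ⟩ := ((hlim h).and ((hlim h').and (Ioc_mem_nhdsGT hτ))).exists
  exact ⟨σ, hσ, hlt, hlt'⟩

variable {E : Type*} [NormedAddCommGroup E] [NormedSpace ℝ E]

theorem eventually_norm_sub_norm_lt {a : ℝ → E} {a' : E} {t c r : ℝ}
    (ha : HasDerivWithinAt a a' (Iic t) t) (h : ∀ σ > 0, ‖a t‖ ≤ ‖a t - σ • a'‖ + c * σ)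
    (hr : c < r) : ∀ᶠ σ in 𝓝[>] (0 : ℝ), ‖a t‖ - ‖a (t - σ)‖ < r * σ := by
  have hmaps : Tendsto (fun σ : ℝ => t - σ) (𝓝[>] 0) (𝓝[≤] t) := by
    refine tendsto_nhdsWithin_iff.2 ⟨?_, ?_⟩
    · have : Tendsto (fun σ : ℝ => t - σ) (𝓝 0) (𝓝 (t - 0)) := by
        exact (continuous_const.sub continuous_id).tendsto 0
      rw [sub_zero] at this
      exact this.mono_left nhdsWithin_le_nhds
    · filter_upwards [self_mem_nhdsWithin] with σ hσ
      exact sub_le_self t (le_of_lt hσ)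
  have hlittle := (hasDerivWithinAt_iff_isLittleO.1 ha).comp_tendsto hmaps
  filter_upwards [hlittle.def (half_pos (sub_pos.2 hr)), self_mem_nhdsWithin] with σ hσ hpos
  have hpos : 0 < σ := hpos
  simp only [Function.comp_apply, sub_sub_cancel_left, neg_smul, sub_neg_eq_add, norm_neg,
    Real.norm_of_nonneg hpos.le] at hσ
  have htri : ‖a t - σ • a'‖ ≤ ‖a (t - σ)‖ + ‖a (t - σ) - a t + σ • a'‖ := by
    rw [show a t - σ • a' = a (t - σ) - (a (t - σ) - a t + σ • a') by abel]
    exact norm_sub_le _ _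
  have := h σ hpos
  have := mul_pos (sub_pos.2 hr) hpos
  linarith

-- The hypothesis `h` says that `a'` is dissipative up to `c`. It is an estimate backwards in time,
-- so it costs no error term in `σ` even where `a'` involves an unbounded operator.
theorem norm_le_norm_add_mul_of_dissipative {a a' : ℝ → E} {τ c : ℝ}
    (hcont : ContinuousOn a (Icc 0 τ))
    (ha : ∀ t ∈ Ioc 0 τ, HasDerivWithinAt a (a' t) (Icc 0 τ) t)
    (h : ∀ t ∈ Ioc 0 τ, ∀ σ > 0, ‖a t‖ ≤ ‖a t - σ • a' t‖ + c * σ) :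
    ∀ t ∈ Icc 0 τ, ‖a t‖ ≤ ‖a 0‖ + c * t := by
  intro t ht
  have key : ∀ s ∈ Icc 0 t, -‖a (t - s)‖ ≤ -‖a t‖ + c * s := by
    refine fun s hs => image_le_of_liminf_slope_right_le_deriv_boundary (f := fun s => -‖a (t - s)‖)
      (B := fun s => -‖a t‖ + c * s) (B' := fun _ => c) ?_ (by simp) (by fun_prop)
      (fun s _ => ?_) (fun s hs r hr => ?_) hs
    · refine (hcont.comp (by fun_prop) fun s hs => ?_).norm.neg
      exact ⟨sub_nonneg.2 hs.2, (sub_le_self t hs.1).trans ht.2⟩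
    · simpa using (((hasDerivAt_id s).const_mul c).const_add (-‖a t‖)).hasDerivWithinAt
    · have hts : t - s ∈ Ioc 0 τ := ⟨sub_pos.2 hs.2, (sub_le_self t hs.1).trans ht.2⟩
      have hleft : HasDerivWithinAt a (a' (t - s)) (Iic (t - s)) (t - s) :=
        (ha _ hts).mono_of_mem_nhdsWithin (mem_of_superset (Ioc_mem_nhdsLE hts.1)
          fun x hx => ⟨hx.1.le, hx.2.trans hts.2⟩)
      have hmap : Tendsto (fun σ => s + σ) (𝓝[>] 0) (𝓝[>] s) := by
        have := (continuous_const_add s).tendsto 0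
        rw [add_zero] at this
        exact this.inf (tendsto_principal_principal.2 fun σ hσ => lt_add_of_pos_right s hσ)
      refine hmap.frequently (((eventually_norm_sub_norm_lt hleft (h _ hts) hr).and
        self_mem_nhdsWithin).mono fun σ hσ => ?_).frequently
      rw [slope_def_field, add_sub_cancel_left, div_lt_iff₀ hσ.2, ← sub_sub]
      linarith [hσ.1]
  have := key t ⟨ht.1, le_rfl⟩
  rw [sub_self] at this
  linarith

end Growth

section Transport

variable {E α : Type*} [NormedAddCommGroup E] {m : MeasurableSpace α} {μ : Measure α}

theorem norm_le_integral_of_ae_norm_le {f : Lp E 1 μ} {g : α → ℝ} (hg : Integrable g μ)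
    (h : ∀ᵐ k ∂μ, ‖f k‖ ≤ g k) : ‖f‖ ≤ ∫ k, g k ∂μ := by
  rw [L1.norm_eq_integral_norm]
  exact integral_mono_ae (L1.integrable_coeFn f).norm hg h

variable [InnerProductSpace ℂ E]

theorem norm_le_norm_add_smul_I_smul {H : E →ₗ[ℂ] E} (hH : H.IsSymmetric) (σ : ℝ) (v : E) :
    ‖v‖ ≤ ‖v + σ • I • H v‖ := by
  have hre : RCLike.re (inner ℂ v (σ • I • H v)) = 0 := by
    have him : (inner ℂ v (H v)).im = 0 := hH.im_inner_self_apply v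
    simp [inner_smul_right, inner_smul_right_eq_smul, him]
  refine le_of_sq_le_sq ?_ (norm_nonneg _)
  rw [norm_add_sq (𝕜 := ℂ), hre]
  nlinarith [sq_nonneg ‖σ • I • H v‖]

/-- The evolution equation `∂ₜa = -i H(k) a + f` on `(0, τ]` for the function `a` of `t` with values
in `L¹`, with `a' = ∂ₜa`. The operator `a ↦ H a` may be unbounded on `L¹`. -/
structure IsTransport (H : α → E →ₗ[ℂ] E) (τ : ℝ) (a a' f : ℝ → Lp E 1 μ) : Prop where
  continuousOn : ContinuousOn a (Icc 0 τ)
  hasDerivWithinAt : ∀ t ∈ Ioc 0 τ, HasDerivWithinAt a (a' t) (Icc 0 τ) t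
  ae_eq : ∀ t ∈ Ioc 0 τ, ∀ᵐ k ∂μ, a' t k = -(I • H k (a t k)) + f t k

namespace IsTransport

variable {H : α → E →ₗ[ℂ] E} {τ c : ℝ} {a a' f b b' g : ℝ → Lp E 1 μ}

theorem mono (ha : IsTransport H τ a a' f) {T : ℝ} (hT : T ≤ τ) : IsTransport H T a a' f where
  continuousOn := ha.continuousOn.mono (Icc_subset_Icc_right hT)
  hasDerivWithinAt t ht :=
    (ha.hasDerivWithinAt t ⟨ht.1, ht.2.trans hT⟩).mono (Icc_subset_Icc_right hT)
  ae_eq t ht := ha.ae_eq t ⟨ht.1, ht.2.trans hT⟩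

theorem add (ha : IsTransport H τ a a' f) (hb : IsTransport H τ b b' g) :
    IsTransport H τ (a + b) (a' + b') (f + g) where
  continuousOn := ha.continuousOn.add hb.continuousOn
  hasDerivWithinAt t ht := (ha.hasDerivWithinAt t ht).add (hb.hasDerivWithinAt t ht)
  ae_eq t ht := by
    filter_upwards [ha.ae_eq t ht, hb.ae_eq t ht, Lp.coeFn_add (a t) (b t),
      Lp.coeFn_add (a' t) (b' t), Lp.coeFn_add (f t) (g t)] with k h1 h2 h3 h4 h5
    simp only [Pi.add_apply, h1, h2, h3, h4, h5, map_add, smul_add]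
    abel

theorem norm_le (hH : ∀ k, (H k).IsSymmetric) (ha : IsTransport H τ a a' f)
    (hf : ∀ t ∈ Ioc 0 τ, ‖f t‖ ≤ c) : ∀ t ∈ Icc 0 τ, ‖a t‖ ≤ ‖a 0‖ + c * t := by
  refine norm_le_norm_add_mul_of_dissipative ha.continuousOn ha.hasDerivWithinAt
    fun t ht σ hσ => ?_
  have hle : ‖a t‖ ≤ ‖a t - σ • a' t + σ • f t‖ := by
    refine Lp.norm_le_norm_of_ae_le ?_
    filter_upwards [ha.ae_eq t ht, Lp.coeFn_add (a t - σ • a' t) (σ • f t), Lp.coeFn_smul σ (f t),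
      Lp.coeFn_sub (a t) (σ • a' t), Lp.coeFn_smul σ (a' t)] with k heq h1 h2 h3 h4
    rw [h1, Pi.add_apply, h2, Pi.smul_apply, h3, Pi.sub_apply, h4, Pi.smul_apply, heq]
    convert norm_le_norm_add_smul_I_smul (hH k) σ (a t k) using 2
    module
  calc ‖a t‖ ≤ ‖a t - σ • a' t‖ + ‖σ • f t‖ := hle.trans (norm_add_le _ _)
    _ ≤ ‖a t - σ • a' t‖ + c * σ := by
      rw [norm_smul, Real.norm_of_nonneg hσ.le, mul_comm]
      gcongr
      exact hf t ht

end IsTransport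

end Transport

/-! ### Fourier uniqueness and convolution in `L¹` -/

section FourierUniqueness

open FourierTransform SchwartzMap
open scoped ContDiff

-- Test functions are Fourier transforms of Schwartz functions, so by self-adjointness of `𝓕` the
-- integral of `f` against any test function vanishes.
theorem ae_eq_zero_of_fourier_eq_zero {V F : Type*} [NormedAddCommGroup V]
    [InnerProductSpace ℝ V] [FiniteDimensional ℝ V] [MeasurableSpace V] [BorelSpace V]
    [NormedAddCommGroup F] [NormedSpace ℂ F] [CompleteSpace F] {f : V → F}
    (hf : Integrable f) (h : ∀ ξ, 𝓕 f ξ = 0) : ∀ᵐ x, f x = 0 := by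
  refine ae_eq_zero_of_integral_contDiff_smul_eq_zero hf.locallyIntegrable fun g hg hsupp => ?_
  have hg' : ContDiff ℝ ∞ (Complex.ofRealCLM ∘ g) := by fun_prop
  have hsupp' : HasCompactSupport (Complex.ofRealCLM ∘ g) := hsupp.comp_left rfl
  let φ : 𝓢(V, ℂ) := hsupp'.toSchwartzMap hg'
  have hφ : 𝓕 ((𝓕⁻ φ : 𝓢(V, ℂ)) : V → ℂ) = φ := by
    rw [← fourier_coe, fourier_fourierInv_eq]
  have hswap : ∫ ξ, 𝓕 ((𝓕⁻ φ : 𝓢(V, ℂ)) : V → ℂ) ξ • f ξ = ∫ x, (𝓕⁻ φ : 𝓢(V, ℂ)) x • 𝓕 f x := by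
    have := VectorFourier.integral_fourierIntegral_smul_eq_flip (e := Real.fourierChar)
      (L := innerₗ V) (μ := volume) (ν := volume) Real.continuous_fourierChar continuous_inner
      (𝓕⁻ φ : 𝓢(V, ℂ)).integrable hf
    rwa [flip_innerₗ] at this
  simp only [hφ, h, smul_zero, integral_zero] at hswap
  rw [← hswap]
  exact integral_congr_ae (.of_forall fun x => (Complex.coe_smul (g x) (f x)).symm)

end FourierUniqueness

section ConvolutionL1

open scoped Convolution

variable {V 𝕜 E F G : Type*} [AddCommGroup V] [MeasurableSpace V] [MeasurableAdd₂ V]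
  [MeasurableNeg V] {μ : Measure V} [SFinite μ] [μ.IsAddRightInvariant] [RCLike 𝕜]
  [NormedAddCommGroup E] [NormedSpace 𝕜 E] [NormedAddCommGroup F] [NormedSpace 𝕜 F]
  [NormedAddCommGroup G] [NormedSpace 𝕜 G] [NormedSpace ℝ G]

theorem integral_norm_convolution_le (B : E →L[𝕜] F →L[𝕜] G) {f : V → E} {g : V → F}
    (hf : Integrable f μ) (hg : Integrable g μ) :
    ∫ x, ‖(f ⋆[B, μ] g) x‖ ∂μ ≤ ‖B‖ * (∫ x, ‖f x‖ ∂μ) * ∫ x, ‖g x‖ ∂μ := by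
  have h := integral_convolution (ContinuousLinearMap.mul ℝ ℝ) hf.norm hg.norm
  simp only [ContinuousLinearMap.mul_apply'] at h
  rw [mul_assoc, ← h, ← integral_const_mul]
  refine integral_mono_ae (hf.integrable_convolution B hg).norm
    ((hf.norm.integrable_convolution (.mul ℝ ℝ) hg.norm).const_mul _) ?_
  filter_upwards [hf.norm.ae_convolution_exists (.mul ℝ ℝ) hg.norm] with x hx
  rw [convolution_def, convolution_def, ← integral_const_mul]
  refine norm_integral_le_of_norm_le (Integrable.const_mul hx _) (.of_forall fun t => ?_)
  simpa [mul_assoc] using B.le_opNorm₂ (f t) (g (x - t))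

variable [SMulCommClass ℝ 𝕜 G]

/-- The convolution `L¹ × L¹ → L¹` associated with a bilinear map `B`, as a bounded bilinear
map. -/
noncomputable def convL1 (B : E →L[𝕜] F →L[𝕜] G) : Lp E 1 μ →L[𝕜] Lp F 1 μ →L[𝕜] Lp G 1 μ :=
  LinearMap.mkContinuous₂
    (LinearMap.mk₂ 𝕜
      (fun f g => ((L1.integrable_coeFn f).integrable_convolution B (L1.integrable_coeFn g)).toL1 _)
      (fun f f' g => by
        rw [← Integrable.toL1_add, Integrable.toL1_eq_toL1_iff,
          convolution_congr B (Lp.coeFn_add f f') .rfl]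
        filter_upwards [(L1.integrable_coeFn f).ae_convolution_exists B (L1.integrable_coeFn g),
          (L1.integrable_coeFn f').ae_convolution_exists B (L1.integrable_coeFn g)] with x h1 h2
        exact h1.add_distrib h2)
      (fun c f g => by
        rw [← Integrable.toL1_smul, Integrable.toL1_eq_toL1_iff,
          convolution_congr B (Lp.coeFn_smul c f) .rfl, smul_convolution]
        rfl)
      (fun f g g' => by
        rw [← Integrable.toL1_add, Integrable.toL1_eq_toL1_iff,
          convolution_congr B .rfl (Lp.coeFn_add g g')]
        filter_upwards [(L1.integrable_coeFn f).ae_convolution_exists B (L1.integrable_coeFn g),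
          (L1.integrable_coeFn f).ae_convolution_exists B (L1.integrable_coeFn g')] with x h1 h2
        exact h1.distrib_add h2)
      (fun c f g => by
        rw [← Integrable.toL1_smul, Integrable.toL1_eq_toL1_iff,
          convolution_congr B .rfl (Lp.coeFn_smul c g), convolution_smul]
        rfl))
    ‖B‖
    (fun f g => by
      rw [LinearMap.mk₂_apply, L1.norm_of_fun_eq_integral_norm, L1.norm_eq_integral_norm,
        L1.norm_eq_integral_norm]
      exact integral_norm_convolution_le B (L1.integrable_coeFn f) (L1.integrable_coeFn g))

theorem coeFn_convL1 (B : E →L[𝕜] F →L[𝕜] G) (f : Lp E 1 μ) (g : Lp F 1 μ) :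
    convL1 B f g =ᵐ[μ] f ⋆[B, μ] g :=
  ((L1.integrable_coeFn f).integrable_convolution B (L1.integrable_coeFn g)).coeFn_toL1

theorem norm_convL1_le (B : E →L[𝕜] F →L[𝕜] G) :
    ‖convL1 (μ := μ) B‖ ≤ ‖B‖ :=
  LinearMap.mkContinuous₂_norm_le _ (norm_nonneg B) _

theorem convL1_leibniz (B : E →L[𝕜] F →L[𝕜] G) (φ : V →+ 𝕜) {f f' : Lp E 1 μ} {g g' : Lp F 1 μ}
    (hf : ∀ᵐ k ∂μ, f' k = φ k • f k) (hg : ∀ᵐ k ∂μ, g' k = φ k • g k) :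
    ∀ᵐ k ∂μ, (convL1 B f' g + convL1 B f g' : Lp G 1 μ) k
      = φ k • (convL1 B f g : Lp G 1 μ) k := by
  filter_upwards [Lp.coeFn_add (convL1 B f' g) (convL1 B f g'), coeFn_convL1 B f' g,
    coeFn_convL1 B f g', coeFn_convL1 B f g,
    ((L1.integrable_coeFn f').congr hf).ae_convolution_exists B (L1.integrable_coeFn g),
    (L1.integrable_coeFn f).ae_convolution_exists B ((L1.integrable_coeFn g').congr hg)]
    with k h1 h2 h3 h4 h5 h6
  rw [h1, Pi.add_apply, h2, h3, h4, convolution_congr B hf .rfl, convolution_congr B .rfl hg]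
  simp only [convolution_def]
  rw [← integral_add h5 h6, ← integral_smul]
  refine integral_congr_ae (.of_forall fun t => ?_)
  have hφ : φ k = φ t + φ (k - t) := by rw [← map_add, add_sub_cancel]
  simp only [map_smul, smul_apply]
  rw [hφ, add_smul]

end ConvolutionL1

/-! ### Functional calculus in an orthonormal eigenbasis -/

section SpectralMap

variable {ι 𝕜 E : Type*} [Fintype ι] [RCLike 𝕜] [NormedAddCommGroup E] [InnerProductSpace 𝕜 E]

variable (𝕜) in
/-- The operator `∑ i, c i • ⟪v i, ·⟫ v i` which, for orthonormal `v`, has the eigenvalue `c i` on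
`v i`; it is linear in the eigenvalues `c`. -/
noncomputable def spectralMap (v : ι → E) : (ι → 𝕜) →ₗ[𝕜] E →L[𝕜] E :=
  Fintype.linearCombination 𝕜 fun i => InnerProductSpace.rankOne 𝕜 (v i) (v i)

theorem spectralMap_apply (v : ι → E) (c : ι → 𝕜) (x : E) :
    spectralMap 𝕜 v c x = ∑ i, (c i * inner 𝕜 (v i) x) • v i := by
  simp [spectralMap, Fintype.linearCombination_apply, mul_smul]

theorem spectralMap_single [DecidableEq ι] (v : ι → E) (i : ι) (x : E) :
    spectralMap 𝕜 v (Pi.single i 1) x = inner 𝕜 (v i) x • v i := by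
  simp [spectralMap]

theorem inner_spectralMap {v : ι → E} (hv : Orthonormal 𝕜 v) (c : ι → 𝕜) (x : E) (i : ι) :
    inner 𝕜 (v i) (spectralMap 𝕜 v c x) = c i * inner 𝕜 (v i) x := by
  rw [spectralMap_apply, hv.inner_right_fintype]

theorem spectralMap_spectralMap {v : ι → E} (hv : Orthonormal 𝕜 v) (c c' : ι → 𝕜) (x : E) :
    spectralMap 𝕜 v c (spectralMap 𝕜 v c' x) = spectralMap 𝕜 v (c * c') x := by
  rw [spectralMap_apply v c, spectralMap_apply v (c * c')]
  simp_rw [inner_spectralMap hv, Pi.mul_apply, mul_assoc]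

theorem norm_sq_spectralMap {v : ι → E} (hv : Orthonormal 𝕜 v) (c : ι → 𝕜) (x : E) :
    ‖spectralMap 𝕜 v c x‖ ^ 2 = ∑ i, ‖c i * inner 𝕜 (v i) x‖ ^ 2 := by
  rw [spectralMap_apply, @norm_sq_eq_re_inner 𝕜, hv.inner_sum, map_sum]
  refine Finset.sum_congr rfl fun i _ => ?_
  rw [RCLike.conj_mul, ← RCLike.ofReal_pow, RCLike.ofReal_re]

theorem norm_spectralMap_le {v : ι → E} (hv : Orthonormal 𝕜 v) {c : ι → 𝕜} {C : ℝ} (hC : 0 ≤ C)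
    (hc : ∀ i, ‖c i‖ ≤ C) (x : E) : ‖spectralMap 𝕜 v c x‖ ≤ C * ‖x‖ := by
  refine le_of_sq_le_sq ?_ (by positivity)
  calc ‖spectralMap 𝕜 v c x‖ ^ 2 = ∑ i, ‖c i * inner 𝕜 (v i) x‖ ^ 2 := norm_sq_spectralMap hv c x
    _ ≤ ∑ i, C ^ 2 * ‖inner 𝕜 (v i) x‖ ^ 2 := by
      gcongr with i
      rw [norm_mul, mul_pow]
      gcongr
      exact hc i
    _ ≤ C ^ 2 * ‖x‖ ^ 2 := by
      rw [← Finset.mul_sum]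
      gcongr
      exact hv.sum_inner_products_le x
    _ = (C * ‖x‖) ^ 2 := (mul_pow _ _ _).symm

theorem map_eq_spectralMap [FiniteDimensional 𝕜 E] {v : ι → E} (hv : Orthonormal 𝕜 v)
    (hcard : Fintype.card ι = Module.finrank 𝕜 E) {T : E →ₗ[𝕜] E} {c : ι → 𝕜}
    (hT : ∀ i, T (v i) = c i • v i) (x : E) : T x = spectralMap 𝕜 v c x := by
  have hspan : ⊤ ≤ Submodule.span 𝕜 (range v) :=
    (hv.linearIndependent.span_eq_top_of_card_eq_finrank' hcard).ge
  let b := OrthonormalBasis.mk hv hspan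
  conv_lhs => rw [← b.sum_repr' x]
  simp [b, spectralMap_apply, hT, smul_smul, mul_comm]

theorem spectralMap_one [FiniteDimensional 𝕜 E] {v : ι → E} (hv : Orthonormal 𝕜 v)
    (hcard : Fintype.card ι = Module.finrank 𝕜 E) (x : E) : spectralMap 𝕜 v 1 x = x :=
  (map_eq_spectralMap hv hcard (T := LinearMap.id) (fun i => by simp) x).symm

theorem stronglyMeasurable_spectralMap {α : Type*} {m : MeasurableSpace α} {v : ι → α → E}
    (hv : ∀ i, StronglyMeasurable (v i)) (c : ι → 𝕜) :
    StronglyMeasurable fun k => spectralMap 𝕜 (fun i => v i k) c := by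
  simp only [spectralMap, Fintype.linearCombination_apply]
  refine Finset.stronglyMeasurable_fun_sum _ fun i _ => StronglyMeasurable.const_smul ?_ (c i)
  have hcont : Continuous fun x : E => InnerProductSpace.rankOne 𝕜 x x := by
    simp_rw [InnerProductSpace.rankOne_def]
    fun_prop
  exact hcont.comp_stronglyMeasurable (hv i)

end SpectralMap

section Multiplier

variable {α 𝕜 E F : Type*} {m : MeasurableSpace α} {μ : Measure α} [NontriviallyNormedField 𝕜]
  [NormedAddCommGroup E] [NormedSpace 𝕜 E] [NormedAddCommGroup F] [NormedSpace 𝕜 F]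

/-- The operator `f ↦ s(·) f(·)` of multiplication by a bounded operator-valued symbol `s`. On the
Fourier side this is the Fourier multiplier with symbol `s`. -/
noncomputable def mulL1 {s : α → E →L[𝕜] F} (hs : MemLp s ∞ μ) : Lp E 1 μ →L[𝕜] Lp F 1 μ :=
  (ContinuousLinearMap.id 𝕜 (E →L[𝕜] F)).holderL μ ∞ 1 1 (hs.toLp s)

theorem coeFn_mulL1 {s : α → E →L[𝕜] F} (hs : MemLp s ∞ μ) (f : Lp E 1 μ) :
    mulL1 hs f =ᵐ[μ] fun k => s k (f k) := by
  filter_upwards [(ContinuousLinearMap.id 𝕜 (E →L[𝕜] F)).coeFn_holder (r := 1) (hs.toLp s) f,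
    hs.coeFn_toLp] with k h1 h2
  rw [← h2]
  exact h1

theorem IsTransport.map_mulL1 {E : Type*} [NormedAddCommGroup E] [InnerProductSpace ℂ E]
    {s : α → E →L[ℂ] E} (hs : MemLp s ∞ μ) {H : α → E →ₗ[ℂ] E}
    (hH : ∀ k v, s k (H k v) = H k (s k v)) {τ : ℝ} {a a' f : ℝ → Lp E 1 μ}
    (ha : IsTransport H τ a a' f) :
    IsTransport H τ (fun t => mulL1 hs (a t)) (fun t => mulL1 hs (a' t))
      (fun t => mulL1 hs (f t)) where
  continuousOn := (mulL1 hs).continuous.comp_continuousOn ha.continuousOn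
  hasDerivWithinAt t ht :=
    ((mulL1 hs).restrictScalars ℝ).hasFDerivAt.comp_hasDerivWithinAt t (ha.hasDerivWithinAt t ht)
  ae_eq t ht := by
    filter_upwards [ha.ae_eq t ht, coeFn_mulL1 hs (a t), coeFn_mulL1 hs (a' t),
      coeFn_mulL1 hs (f t)] with k h1 h2 h3 h4
    rw [h2, h3, h4, h1, map_add, map_neg, map_smul, hH]

end Multiplier

/-! ### The Wiener algebra -/

namespace Wiener

variable {d n : ℕ}

section Eval

open FourierTransform

/-- The normalization constant `(2π)^{-d/2}` in `Wiener.eval`. -/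
noncomputable def evalConst (d : ℕ) : ℝ := (2 * Real.pi) ^ (-(d : ℝ) / 2)

theorem evalConst_pos (d : ℕ) : 0 < evalConst d := by unfold evalConst; positivity

theorem eval_eq_fourier (f : Wiener d n) (x : Rd d) :
    eval f x = evalConst d • 𝓕 (f : Rd d → Cn n) (-((2 * Real.pi)⁻¹ • x)) := by
  unfold eval evalConst
  congr 1
  rw [Real.fourier_eq']
  congr 1 with k : 1
  congr 2
  rw [inner_neg_right, inner_smul_right]
  push_cast
  have : (Real.pi : ℂ) ≠ 0 := by exact_mod_cast Real.pi_ne_zero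
  field_simp

theorem eval_congr_ae {f : Wiener d n} {g : Rd d → Cn n} (h : f =ᵐ[volume] g) (x : Rd d) :
    eval f x = evalConst d • ∫ k : Rd d, exp (I * ((inner ℝ k x : ℝ) : ℂ)) • g k := by
  unfold eval evalConst
  congr 1
  exact integral_congr_ae (h.mono fun k hk => by simp only [hk])

theorem integrable_exp_smul {E : Type*} [NormedAddCommGroup E] [NormedSpace ℂ E] {f : Rd d → E}
    (hf : Integrable f) (x : Rd d) :
    Integrable fun k => exp (I * ((inner ℝ k x : ℝ) : ℂ)) • f k := by
  have hexp : Continuous fun k : Rd d => exp (I * ((inner ℝ k x : ℝ) : ℂ)) := by fun_prop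
  exact hf.bdd_smul 1 hexp.aestronglyMeasurable (.of_forall fun k => (norm_exp_I_mul_ofReal _).le)

/-- Evaluation at `x` as a linear map. -/
noncomputable def evalₗ (x : Rd d) : Wiener d n →ₗ[ℂ] Cn n where
  toFun f := eval f x
  map_add' f g := by
    rw [eval_congr_ae (Lp.coeFn_add f g)]
    simp only [Pi.add_apply, smul_add]
    rw [integral_add (integrable_exp_smul (L1.integrable_coeFn f) x)
      (integrable_exp_smul (L1.integrable_coeFn g) x), smul_add]
    rfl
  map_smul' c f := by
    rw [eval_congr_ae (Lp.coeFn_smul c f)]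
    simp only [Pi.smul_apply]
    simp_rw [smul_comm _ c]
    rw [integral_smul, smul_comm]
    rfl

theorem evalₗ_apply (x : Rd d) (f : Wiener d n) : evalₗ x f = eval f x := rfl

theorem eq_of_eval_eq {f g : Wiener d n} (h : ∀ x, eval f x = eval g x) : f = g := by
  rw [← sub_eq_zero, Lp.eq_zero_iff_ae_eq_zero]
  refine ae_eq_zero_of_fourier_eq_zero (L1.integrable_coeFn _) fun ξ => ?_
  have := eval_eq_fourier (f - g) (-((2 * Real.pi) • ξ))
  rw [← evalₗ_apply, map_sub, evalₗ_apply, evalₗ_apply, h, sub_self, eq_comm,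
    smul_eq_zero_iff_right (evalConst_pos d).ne', smul_neg, neg_neg, smul_smul,
    inv_mul_cancel₀ (by positivity), one_smul] at this
  exact this

theorem ae_eq_of_integral_exp_smul_eq {f g : Rd d → Cn n} (hf : Integrable f) (hg : Integrable g)
    (h : ∀ x : Rd d, ∫ k : Rd d, exp (I * ((inner ℝ k x : ℝ) : ℂ)) • f k
      = ∫ k : Rd d, exp (I * ((inner ℝ k x : ℝ) : ℂ)) • g k) : f =ᵐ[volume] g := by
  refine (Integrable.toL1_eq_toL1_iff f g hf hg).1 (eq_of_eval_eq fun x => ?_)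
  rw [eval_congr_ae hf.coeFn_toL1, eval_congr_ae hg.coeFn_toL1, h]

theorem continuous_eval (f : Wiener d n) : Continuous (eval f) := by
  refine Continuous.const_smul (M := ℝ) ?_ _
  refine continuous_of_dominated (bound := fun k => ‖f k‖)
    (fun x => (integrable_exp_smul (L1.integrable_coeFn f) x).aestronglyMeasurable)
    (fun x => .of_forall fun k => ?_) (L1.integrable_coeFn f).norm (.of_forall fun k => by fun_prop)
  rw [norm_smul, norm_exp_I_mul_ofReal, one_mul]

theorem eval_compLp (T : Cn n →L[ℂ] Cn n) (f : Wiener d n) (x : Rd d) :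
    eval (T.compLp f) x = T (eval f x) := by
  rw [eval_congr_ae (T.coeFn_compLp f)]
  simp_rw [← map_smul]
  rw [T.integral_comp_comm (integrable_exp_smul (L1.integrable_coeFn f) x)]
  exact (map_smul (T.restrictScalars ℝ) _ _).symm

end Eval

/-- `g = ∂_l f` on the Fourier side: `ĝ(k) = i k_l f̂(k)`. -/
def HasFourierPartial (l : Fin d) (f g : Wiener d n) : Prop :=
  ∀ᵐ k : Rd d, g k = (I * (k l : ℂ)) • f k

section Partial

theorem exp_inner_add_single (k x : Rd d) (l : Fin d) (s : ℝ) :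
    exp (I * ((inner ℝ k (x + s • EuclideanSpace.single l 1) : ℝ) : ℂ))
      = exp (I * ((inner ℝ k x : ℝ) : ℂ)) * exp (I * (k l : ℂ) * (s : ℂ)) := by
  rw [← exp_add, inner_add_right, inner_smul_right, EuclideanSpace.inner_single_right]
  congr 1
  simp
  ring

theorem exp_sub_one_eq_mul_integral (c : ℂ) (t : ℝ) :
    exp (c * t) - 1 = c * ∫ s in (0 : ℝ)..t, exp (c * s) := by
  rcases eq_or_ne c 0 with rfl | hc
  · simp
  · rw [integral_exp_mul_complex hc, mul_div_cancel₀ _ hc, ofReal_zero, mul_zero, exp_zero]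

theorem norm_integral_exp_le (y t : ℝ) :
    ‖∫ s in (0 : ℝ)..t, exp (I * (y : ℂ) * (s : ℂ))‖ ≤ |t| := by
  have := intervalIntegral.norm_integral_le_of_norm_le_const (a := 0) (b := t) (C := 1)
    (f := fun s : ℝ => exp (I * (y : ℂ) * (s : ℂ))) fun s _ => by
      rw [mul_assoc, ← ofReal_mul, norm_exp_I_mul_ofReal]
  simpa using this

theorem IsPartial.eval_add_single_sub {l : Fin d} {f g : Wiener d n} (h : IsPartial l f g)
    (x : Rd d) (t : ℝ) : eval f (x + t • EuclideanSpace.single l 1) - eval f x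
      = ∫ s in (0 : ℝ)..t, eval g (x + s • EuclideanSpace.single l 1) := by
  have hderiv : ∀ s : ℝ, HasDerivAt (fun s : ℝ => eval f (x + s • EuclideanSpace.single l 1))
      (eval g (x + s • EuclideanSpace.single l 1)) s := by
    intro s
    have h0 := h (x + s • EuclideanSpace.single l 1)
    rw [HasLineDerivAt, ← sub_self s] at h0
    simpa [add_assoc, ← add_smul] using h0.comp_sub_const s s
  rw [intervalIntegral.integral_eq_sub_of_hasDerivAt (fun s _ => hderiv s)
    (((continuous_eval g).comp (by fun_prop)).intervalIntegrable _ _), zero_smul, add_zero]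

theorem integral_eval_add_single (g : Wiener d n) (l : Fin d) (x : Rd d) (t : ℝ) :
    ∫ s in (0 : ℝ)..t, eval g (x + s • EuclideanSpace.single l 1)
      = evalConst d • ∫ k : Rd d, exp (I * ((inner ℝ k x : ℝ) : ℂ)) •
          (∫ s in (0 : ℝ)..t, exp (I * (k l : ℂ) * (s : ℂ))) • g k := by
  unfold eval
  rw [intervalIntegral.integral_smul]
  congr 1
  rw [intervalIntegral_integral_swap]
  · refine integral_congr_ae (.of_forall fun k => ?_)
    simp only [exp_inner_add_single, mul_smul]
    rw [intervalIntegral.integral_smul, intervalIntegral.integral_smul_const]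
  · have : IsFiniteMeasure (volume.restrict (uIoc 0 t)) :=
      ⟨by rw [Measure.restrict_apply_univ, uIoc]; exact measure_Ioc_lt_top⟩
    have hg : Integrable (fun z : ℝ × Rd d => g z.2) ((volume.restrict (uIoc 0 t)).prod volume) :=
      (L1.integrable_coeFn g).comp_snd _
    have hexp : Continuous fun z : ℝ × Rd d =>
        exp (I * ((inner ℝ z.2 (x + z.1 • EuclideanSpace.single l 1) : ℝ) : ℂ)) := by fun_prop
    exact hg.bdd_smul 1 hexp.aestronglyMeasurable
      (.of_forall fun z => (norm_exp_I_mul_ofReal _).le)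

theorem IsPartial.ae_exp_sub_one_smul {l : Fin d} {f g : Wiener d n} (h : IsPartial l f g)
    (t : ℝ) : ∀ᵐ k : Rd d, (exp (I * (k l : ℂ) * (t : ℂ)) - 1) • f k
      = (∫ s in (0 : ℝ)..t, exp (I * (k l : ℂ) * (s : ℂ))) • g k := by
  have hf : Integrable fun k : Rd d => (exp (I * (k l : ℂ) * (t : ℂ)) - 1) • f k := by
    refine (L1.integrable_coeFn f).bdd_smul 2 (by fun_prop : Continuous fun k : Rd d =>
      exp (I * (k l : ℂ) * (t : ℂ)) - 1).aestronglyMeasurable (.of_forall fun k => ?_)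
    refine (norm_sub_le _ _).trans_eq ?_
    rw [mul_assoc, ← ofReal_mul, norm_exp_I_mul_ofReal, norm_one, one_add_one_eq_two]
  have hg : Integrable fun k : Rd d =>
      (∫ s in (0 : ℝ)..t, exp (I * (k l : ℂ) * (s : ℂ))) • g k :=
    (L1.integrable_coeFn g).bdd_smul |t|
      (intervalIntegral.continuous_parametric_intervalIntegral_of_continuous'
        (f := fun (k : Rd d) (s : ℝ) => exp (I * (k l : ℂ) * (s : ℂ)))
        (by fun_prop) 0 t).aestronglyMeasurable
      (.of_forall fun k => norm_integral_exp_le _ _)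
  refine ae_eq_of_integral_exp_smul_eq hf hg fun x => ?_
  refine smul_right_injective (Cn n) (evalConst_pos d).ne' ?_
  simp only [← integral_eval_add_single, ← h.eval_add_single_sub]
  unfold eval evalConst
  rw [← smul_sub, ← integral_sub (integrable_exp_smul (L1.integrable_coeFn f) _)
    (integrable_exp_smul (L1.integrable_coeFn f) _)]
  congr 2 with k : 1
  rw [exp_inner_add_single, smul_smul, mul_sub, sub_smul, mul_one]

theorem IsPartial.hasFourierPartial {l : Fin d} {f g : Wiener d n} (h : IsPartial l f g) :
    HasFourierPartial l f g := by
  have hall := ae_all_iff.2 fun m : ℕ => h.ae_exp_sub_one_smul (1 / ((m : ℝ) + 1))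
  filter_upwards [hall] with k hk
  have hderiv : HasDerivAt (fun t : ℝ => ∫ s in (0 : ℝ)..t, exp (I * (k l : ℂ) * (s : ℂ))) 1 0 := by
    have hc : Continuous fun s : ℝ => exp (I * (k l : ℂ) * (s : ℂ)) := by fun_prop
    simpa using (hc.integral_hasStrictDerivAt 0 0).hasDerivAt
  have hseq : Filter.Tendsto (fun m : ℕ => 1 / ((m : ℝ) + 1)) Filter.atTop (nhdsWithin 0 {0}ᶜ) :=
    tendsto_nhdsWithin_iff.2 ⟨tendsto_one_div_add_atTop_nhds_zero_nat,
      .of_forall fun m => (by positivity : (1 : ℝ) / ((m : ℝ) + 1) ≠ 0)⟩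
  obtain ⟨m, hm⟩ := (hseq.eventually (hderiv.eventually_ne (c := 0) one_ne_zero)).exists
  have := hk m
  rw [exp_sub_one_eq_mul_integral, mul_comm, mul_smul] at this
  exact (smul_right_injective _ hm this).symm

theorem MemW1.isPartial_partialD {f : Wiener d n} (h : MemW1 f) (l : Fin d) :
    IsPartial l f (partialD l f) := by
  unfold partialD
  rw [dif_pos (h l)]
  exact (h l).choose_spec

theorem MemW1.hasFourierPartial {f : Wiener d n} (h : MemW1 f) (l : Fin d) :
    HasFourierPartial l f (partialD l f) := (h.isPartial_partialD l).hasFourierPartial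

theorem MemW1.lineDeriv_eval {f : Wiener d n} (h : MemW1 f) (l : Fin d) (x : Rd d) :
    lineDeriv ℝ (eval f) x (EuclideanSpace.single l 1) = eval (partialD l f) x :=
  (h.isPartial_partialD l x).lineDeriv

end Partial

theorem HasFourierPartial.add {l : Fin d} {f f' g g' : Wiener d n} (hf : HasFourierPartial l f f')
    (hg : HasFourierPartial l g g') : HasFourierPartial l (f + g) (f' + g') := by
  filter_upwards [hf, hg, Lp.coeFn_add f g, Lp.coeFn_add f' g'] with k h1 h2 h3 h4
  rw [h3, h4, Pi.add_apply, Pi.add_apply, h1, h2, smul_add]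

theorem HasFourierPartial.const_smul {l : Fin d} {f f' : Wiener d n} (c : ℂ)
    (h : HasFourierPartial l f f') : HasFourierPartial l (c • f) (c • f') := by
  filter_upwards [h, Lp.coeFn_smul c f, Lp.coeFn_smul c f'] with k h1 h2 h3
  rw [h2, h3, Pi.smul_apply, Pi.smul_apply, h1, smul_comm]

theorem HasFourierPartial.map_mulL1 {l : Fin d} {f f' : Wiener d n} {s : Rd d → Cn n →L[ℂ] Cn n}
    (hs : MemLp s ∞) (h : HasFourierPartial l f f') :
    HasFourierPartial l (mulL1 hs f) (mulL1 hs f') := by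
  filter_upwards [h, coeFn_mulL1 hs f, coeFn_mulL1 hs f'] with k h1 h2 h3
  rw [h2, h3, h1, map_smul]

theorem norm_mul_of_hasFourierPartial {l : Fin d} {f f' : Wiener d n}
    (h : HasFourierPartial l f f') : ∀ᵐ k : Rd d, |k l| * ‖f k‖ = ‖f' k‖ := by
  filter_upwards [h] with k hk
  rw [hk, norm_smul, norm_mul, norm_I, one_mul, norm_real, Real.norm_eq_abs]

-- A symbol of order one acts boundedly from `W¹` to `W`.
theorem exists_ae_eq_norm_le_of_hasFourierPartial {f : Wiener d n} {f' : Fin d → Wiener d n}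
    (hf : ∀ l, HasFourierPartial l f (f' l)) {q : Rd d → Cn n} (hq : AEStronglyMeasurable q volume)
    {C : ℝ} (hC : ∀ᵐ k : Rd d, ‖q k‖ ≤ C * (∑ l, |k l|) * ‖f k‖) :
    ∃ g : Wiener d n, g =ᵐ[volume] q ∧ ‖g‖ ≤ C * ∑ l, ‖f' l‖ := by
  have hint : Integrable (fun k : Rd d => C * ∑ l, ‖f' l k‖) :=
    (integrable_finsetSum _ fun l _ => (L1.integrable_coeFn (f' l)).norm).const_mul C
  have hle : ∀ᵐ k : Rd d, ‖q k‖ ≤ C * ∑ l, ‖f' l k‖ := by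
    filter_upwards [hC, ae_all_iff.2 fun l => norm_mul_of_hasFourierPartial (hf l)]
      with k hCk hk
    refine hCk.trans_eq ?_
    rw [mul_assoc, Finset.sum_mul]
    simp_rw [hk]
  have hqi : Integrable q := hint.mono' hq hle
  refine ⟨hqi.toL1 q, hqi.coeFn_toL1, ?_⟩
  have hle' : ∀ᵐ k : Rd d, ‖hqi.toL1 q k‖ ≤ C * ∑ l, ‖f' l k‖ := by
    filter_upwards [hle, hqi.coeFn_toL1] with k h1 h2
    rwa [h2]
  refine (norm_le_integral_of_ae_norm_le hint hle').trans_eq ?_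
  rw [integral_const_mul, integral_finsetSum _ fun l _ => (L1.integrable_coeFn (f' l)).norm]
  simp_rw [L1.norm_eq_integral_norm]

theorem norm_le_normW1 (f : Wiener d n) : ‖f‖ ≤ normW1 f :=
  le_add_of_nonneg_right (Finset.sum_nonneg fun _ _ => norm_nonneg _)

theorem normW1_nonneg (f : Wiener d n) : 0 ≤ normW1 f := (norm_nonneg f).trans (norm_le_normW1 f)

theorem norm_partialD_le_normW1 (f : Wiener d n) (l : Fin d) : ‖partialD l f‖ ≤ normW1 f := by
  have := Finset.single_le_sum (f := fun l => ‖partialD l f‖) (fun _ _ => norm_nonneg _)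
    (Finset.mem_univ l)
  linarith [norm_nonneg f, this, show normW1 f = ‖f‖ + ∑ l, ‖partialD l f‖ from rfl]

end Wiener

/-! ### The cubic nonlinearity -/

section Multilinear

variable {𝕜 ι G : Type*} {E : ι → Type*} [NontriviallyNormedField 𝕜] [Fintype ι] [DecidableEq ι]
  [∀ i, NormedAddCommGroup (E i)] [∀ i, NormedSpace 𝕜 (E i)] [NormedAddCommGroup G]
  [NormedSpace 𝕜 G]

theorem norm_linearDeriv_le (f : ContinuousMultilinearMap 𝕜 E G) (m v : ∀ i, E i) :
    ‖f.linearDeriv m v‖ ≤ ‖f‖ * Fintype.card ι * ‖m‖ ^ (Fintype.card ι - 1) * ‖v‖ := by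
  have hprod : ∀ i, ∏ j, ‖Function.update m i (v i) j‖ ≤ ‖v‖ * ‖m‖ ^ (Fintype.card ι - 1) := by
    intro i
    rw [← Finset.mul_prod_erase _ _ (Finset.mem_univ i), Function.update_self,
      ← Finset.card_univ, ← Finset.card_erase_of_mem (Finset.mem_univ i)]
    refine mul_le_mul (norm_le_pi_norm v i) ?_ (by positivity) (norm_nonneg _)
    refine (Finset.prod_le_prod (fun j _ => norm_nonneg _) fun j hj => ?_).trans_eq
      (Finset.prod_const _)
    rw [Function.update_of_ne (Finset.ne_of_mem_erase hj)]
    exact norm_le_pi_norm m j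
  rw [ContinuousMultilinearMap.linearDeriv_apply]
  calc ‖∑ i, f (Function.update m i (v i))‖
      ≤ ∑ _i : ι, ‖f‖ * (‖v‖ * ‖m‖ ^ (Fintype.card ι - 1)) :=
        norm_sum_le_of_le _ fun i _ => (f.le_opNorm _).trans (by gcongr; exact hprod i)
    _ = ‖f‖ * Fintype.card ι * ‖m‖ ^ (Fintype.card ι - 1) * ‖v‖ := by
        rw [Finset.sum_const, Finset.card_univ, nsmul_eq_mul]
        ring

end Multilinear

open FourierTransform in
theorem fourier_convL1 {V E F G : Type*} [NormedAddCommGroup V]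
    [InnerProductSpace ℝ V] [FiniteDimensional ℝ V] [MeasurableSpace V] [BorelSpace V]
    [NormedAddCommGroup E] [NormedSpace ℂ E] [CompleteSpace E] [NormedAddCommGroup F]
    [NormedSpace ℂ F] [CompleteSpace F] [NormedAddCommGroup G] [NormedSpace ℂ G] [CompleteSpace G]
    (B : E →L[ℂ] F →L[ℂ] G) (f : Lp E 1 (volume : Measure V)) (g : Lp F 1 (volume : Measure V))
    (ξ : V) : 𝓕 (convL1 B f g : V → G) ξ = B (𝓕 (f : V → E) ξ) (𝓕 (g : V → F) ξ) := by
  rw [← Real.fourier_bilin_convolution_eq _ (L1.integrable_coeFn _) (L1.integrable_coeFn _),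
    Real.fourier_eq', Real.fourier_eq']
  exact integral_congr_ae ((coeFn_convL1 B f g).mono fun k hk => by simp only [hk])

section Trilinear

set_option maxSynthPendingDepth 3

variable {𝕜 V E F : Type*} [RCLike 𝕜] [NormedAddCommGroup E] [NormedSpace 𝕜 E]
  [NormedAddCommGroup F] [NormedSpace 𝕜 F]

section Coordinates

variable {ι : Type*} [Fintype ι]

/-- The trilinear map `(x, y, z) ↦ ∑ φᵢ(x) φⱼ(y) φₖ(z) tᵢⱼₖ`. -/
noncomputable def trilinearOfCoords (φ : ι → E →L[𝕜] 𝕜) (t : ι → ι → ι → F) :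
    E →L[𝕜] E →L[𝕜] E →L[𝕜] F :=
  ∑ i, ∑ j, ∑ k, (φ i).smulRight ((φ j).smulRight ((φ k).smulRight (t i j k)))

theorem trilinearOfCoords_apply (φ : ι → E →L[𝕜] 𝕜) (t : ι → ι → ι → F) (x y z : E) :
    trilinearOfCoords φ t x y z = ∑ i, ∑ j, ∑ k, (φ i x * φ j y * φ k z) • t i j k := by
  simp [trilinearOfCoords, mul_smul]

end Coordinates

variable [NormedSpace ℝ F] [SMulCommClass ℝ 𝕜 F] [AddCommGroup V] [MeasurableSpace V]
  [MeasurableAdd₂ V] [MeasurableNeg V] {μ : Measure V} [SFinite μ] [μ.IsAddRightInvariant]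

/-- The iterated convolution `(L¹)³ → L¹` associated with a trilinear map `T`. -/
noncomputable def convL1₃ (T : E →L[𝕜] E →L[𝕜] E →L[𝕜] F) :
    ContinuousMultilinearMap 𝕜 (fun _ : Fin 3 => Lp E 1 μ) (Lp F 1 μ) :=
  MultilinearMap.mkContinuous
    (.mk' (fun m => convL1 (.id 𝕜 (E →L[𝕜] F)) (convL1 T (m 0) (m 1)) (m 2))
      (fun m i x y => by fin_cases i <;> simp) (fun m i c x => by fin_cases i <;> simp))
    ‖T‖ fun m => by
      simp only [MultilinearMap.mk'_apply, Fin.prod_univ_three]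
      calc ‖convL1 (.id 𝕜 (E →L[𝕜] F)) (convL1 T (m 0) (m 1)) (m 2)‖
          ≤ 1 * (‖T‖ * ‖m 0‖ * ‖m 1‖) * ‖m 2‖ :=
            ContinuousLinearMap.le_of_opNorm₂_le_of_le _
              ((norm_convL1_le _).trans ContinuousLinearMap.norm_id_le)
              (ContinuousLinearMap.le_of_opNorm₂_le_of_le _ (norm_convL1_le T) le_rfl le_rfl) le_rfl
        _ = ‖T‖ * (‖m 0‖ * ‖m 1‖ * ‖m 2‖) := by ring

theorem convL1₃_apply (T : E →L[𝕜] E →L[𝕜] E →L[𝕜] F) (m : Fin 3 → Lp E 1 μ) :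
    convL1₃ T m = convL1 (.id 𝕜 (E →L[𝕜] F)) (convL1 T (m 0) (m 1)) (m 2) := rfl

theorem norm_convL1₃_le (T : E →L[𝕜] E →L[𝕜] E →L[𝕜] F) : ‖convL1₃ (μ := μ) T‖ ≤ ‖T‖ :=
  MultilinearMap.mkContinuous_norm_le _ (norm_nonneg T) _

theorem convL1₃_leibniz (T : E →L[𝕜] E →L[𝕜] E →L[𝕜] F) (φ : V →+ 𝕜) {m m' : Fin 3 → Lp E 1 μ}
    (h : ∀ i, ∀ᵐ k ∂μ, m' i k = φ k • m i k) :
    ∀ᵐ k ∂μ, ((convL1₃ T).linearDeriv m m' : Lp F 1 μ) k = φ k • (convL1₃ T m : Lp F 1 μ) k := by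
  have := convL1_leibniz (.id 𝕜 (E →L[𝕜] F)) φ (convL1_leibniz T φ (h 0) (h 1)) (h 2)
  rw [map_add, add_apply] at this
  simpa [ContinuousMultilinearMap.linearDeriv_apply, Fin.sum_univ_three, convL1₃_apply] using this

end Trilinear

namespace HypSystem

variable {d n : ℕ} (Q : HypSystem d n)

/-- The map `TC` as a continuous trilinear map, in curried form. -/
noncomputable def TCL : Cn n →L[ℂ] Cn n →L[ℂ] Cn n →L[ℂ] Cn n :=
  trilinearOfCoords (fun i => EuclideanSpace.proj i) fun i j k => WithLp.toLp 2 fun m =>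
    ((Q.T (EuclideanSpace.single i 1) (EuclideanSpace.single j 1)
      (EuclideanSpace.single k 1) m : ℝ) : ℂ)

theorem TCL_apply (a b c : Cn n) : Q.TCL a b c = Q.TC a b c := by
  ext m
  simp [TCL, trilinearOfCoords_apply, TC]

/-- The map `(f₀, f₁, f₂) ↦ T(f₀, f₁, f₂)` on `W`; a product of functions is a convolution of
their Fourier transforms. -/
noncomputable def triW : ContinuousMultilinearMap ℂ (fun _ : Fin 3 => Wiener d n) (Wiener d n) :=
  ((Wiener.evalConst d : ℂ) ^ 2) • convL1₃ Q.TCL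

theorem eval_triW (m : Fin 3 → Wiener d n) (x : Rd d) : Wiener.eval (Q.triW m) x
    = Q.TC (Wiener.eval (m 0) x) (Wiener.eval (m 1) x) (Wiener.eval (m 2) x) := by
  rw [triW, smul_apply, ← Wiener.evalₗ_apply, map_smul, Wiener.evalₗ_apply, convL1₃_apply]
  simp only [Wiener.eval_eq_fourier, fourier_convL1, ContinuousLinearMap.id_apply, ← TCL_apply,
    ← Complex.coe_smul (Wiener.evalConst d), map_smul, smul_apply, smul_smul]
  congr 1
  ring

set_option maxSynthPendingDepth 3 in
theorem norm_triW_le {CT : ℝ} (h0 : 0 ≤ CT)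
    (hT : ∀ a b c : Cn n, ‖Q.TC a b c‖ ≤ CT * ‖a‖ * ‖b‖ * ‖c‖) :
    ‖Q.triW (d := d)‖ ≤ Wiener.evalConst d ^ 2 * CT := by
  have hTCL : ‖Q.TCL‖ ≤ CT := Q.TCL.opNorm_le_bound₂ h0 fun a b =>
    ContinuousLinearMap.opNorm_le_bound _ (by positivity) fun c => by
      rw [TCL_apply]
      exact hT a b c
  rw [triW, norm_smul, norm_pow, norm_real, Real.norm_of_nonneg (Wiener.evalConst_pos d).le]
  gcongr
  exact (norm_convL1₃_le _).trans hTCL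

end HypSystem

namespace Wiener

variable {d n : ℕ}

/-- The Fourier multiplier `i k_l`, as an additive map. -/
noncomputable def partialSymbol (l : Fin d) : Rd d →+ ℂ where
  toFun k := I * (k l : ℂ)
  map_zero' := by simp
  map_add' x y := by simp [mul_add]

theorem HasFourierPartial.triW (Q : HypSystem d n) {l : Fin d} {m m' : Fin 3 → Wiener d n}
    (h : ∀ i, HasFourierPartial l (m i) (m' i)) :
    HasFourierPartial l (Q.triW m) (Q.triW.linearDeriv m m') := by
  have := HasFourierPartial.const_smul ((evalConst d : ℂ) ^ 2)
    (convL1₃_leibniz Q.TCL (partialSymbol l) h)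
  simpa [HypSystem.triW, ContinuousMultilinearMap.linearDeriv_apply, Finset.smul_sum] using this

end Wiener

section Conjugation

variable {d n : ℕ}

theorem norm_conjVec (v : Cn n) : ‖conjVec v‖ = ‖v‖ := by
  simp [EuclideanSpace.norm_eq, conjVec]

theorem conjVec_smul (c : ℂ) (v : Cn n) : conjVec (c • v) = starRingEnd ℂ c • conjVec v := by
  ext m; simp [conjVec]

/-- Entrywise complex conjugation as a real linear isometry. -/
noncomputable def conjVecₗᵢ (n : ℕ) : Cn n →ₗᵢ[ℝ] Cn n where
  toFun := conjVec
  map_add' v w := by ext m; simp [conjVec]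
  map_smul' c v := by ext m; simp [conjVec]
  norm_map' := norm_conjVec

namespace Wiener

/-- Complex conjugation `f ↦ conj f` on `W`; it conjugates and reflects the Fourier transform. -/
noncomputable def conjW : Wiener d n →L[ℝ] Wiener d n :=
  (conjVecₗᵢ n).toContinuousLinearMap.compLpL 1 volume ∘L
    (Lp.compMeasurePreservingₗᵢ ℝ Neg.neg
      (Measure.measurePreserving_neg (volume : Measure (Rd d)))).toContinuousLinearMap

theorem coeFn_conjW (f : Wiener d n) : conjW f =ᵐ[volume] fun k => conjVec (f (-k)) := by
  have hneg := Measure.measurePreserving_neg (volume : Measure (Rd d))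
  filter_upwards [(conjVecₗᵢ n).toContinuousLinearMap.coeFn_compLp
      (Lp.compMeasurePreserving Neg.neg hneg f),
    Lp.coeFn_compMeasurePreserving f hneg] with k h1 h2
  exact h1.trans (congrArg conjVec h2)

theorem norm_conjW_le : ‖conjW (d := d) (n := n)‖ ≤ 1 := by
  refine (ContinuousLinearMap.opNorm_comp_le _ _).trans
    (mul_le_one₀ ?_ (norm_nonneg _) (LinearIsometry.norm_toContinuousLinearMap_le _))
  exact (ContinuousLinearMap.norm_compLpL_le _).trans
    (LinearIsometry.norm_toContinuousLinearMap_le _)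

theorem eval_conjW (f : Wiener d n) (x : Rd d) : eval (conjW f) x = conjVec (eval f x) := by
  have hint := ((conjVecₗᵢ n).toContinuousLinearMap.integral_comp_comm
    (integrable_exp_smul (L1.integrable_coeFn f) x)).symm
  rw [eval_congr_ae (coeFn_conjW f), eval]
  refine Eq.trans ?_ ((conjVecₗᵢ n).map_smul _ _).symm
  refine congrArg _ (Eq.trans ?_ hint.symm)
  rw [← integral_neg_eq_self]
  congr 1 with k : 1
  change _ = conjVec _
  rw [conjVec_smul, neg_neg, ← Complex.exp_conj]
  congr 2
  simp

theorem HasFourierPartial.conjW {l : Fin d} {f g : Wiener d n} (h : HasFourierPartial l f g) :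
    HasFourierPartial l (conjW f) (conjW g) := by
  have hneg := (Measure.measurePreserving_neg
    (volume : Measure (Rd d))).quasiMeasurePreserving.ae h
  filter_upwards [coeFn_conjW f, coeFn_conjW g, hneg] with k h1 h2 h3
  rw [h1, h2, h3, conjVec_smul]
  simp

end Wiener

end Conjugation

namespace Wiener

variable {d n : ℕ}

/-- The mode `u_j`, `j ∈ {±1, ±3}`, as a bounded linear function of the pair `(u₁, u₃)`; the
counterpart of `modeVal`. -/
noncomputable def modeL (j : ℤ) : (Wiener d n × Wiener d n) →L[ℝ] Wiener d n :=
  if j = 1 then .fst ℝ _ _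
  else if j = 3 then .snd ℝ _ _
  else if j = -1 then conjW ∘L .fst ℝ _ _
  else if j = -3 then conjW ∘L .snd ℝ _ _
  else 0

theorem norm_modeL_le (j : ℤ) : ‖modeL (d := d) (n := n) j‖ ≤ 1 := by
  unfold modeL
  split_ifs
  · exact ContinuousLinearMap.norm_fst_le ..
  · exact ContinuousLinearMap.norm_snd_le ..
  · exact (ContinuousLinearMap.opNorm_comp_le _ _).trans
      (mul_le_one₀ norm_conjW_le (norm_nonneg _) (ContinuousLinearMap.norm_fst_le ..))
  · exact (ContinuousLinearMap.opNorm_comp_le _ _).trans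
      (mul_le_one₀ norm_conjW_le (norm_nonneg _) (ContinuousLinearMap.norm_snd_le ..))
  · rw [norm_zero]
    exact zero_le_one

theorem eval_modeL (j : ℤ) (U : Wiener d n × Wiener d n) (x : Rd d) :
    eval (modeL j U) x = modeVal U.1 U.2 j x := by
  unfold modeL modeVal
  split_ifs
  · rfl
  · rfl
  · exact eval_conjW _ x
  · exact eval_conjW _ x
  · exact map_zero (evalₗ x)

theorem HasFourierPartial.zero {l : Fin d} : HasFourierPartial l (0 : Wiener d n) 0 := by
  filter_upwards [Lp.coeFn_zero (Cn n) 1 (volume : Measure (Rd d))] with k h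
  rw [h, Pi.zero_apply, smul_zero]

theorem HasFourierPartial.modeL {l : Fin d} {U U' : Wiener d n × Wiener d n}
    (h₁ : HasFourierPartial l U.1 U'.1) (h₃ : HasFourierPartial l U.2 U'.2) (j : ℤ) :
    HasFourierPartial l (modeL j U) (modeL j U') := by
  unfold Wiener.modeL
  split_ifs
  exacts [h₁, h₃, h₁.conjW, h₃.conjW, .zero]

theorem HasFourierPartial.sum {ι : Type*} {l : Fin d} {f g : ι → Wiener d n} (s : Finset ι)
    (h : ∀ i ∈ s, HasFourierPartial l (f i) (g i)) :
    HasFourierPartial l (∑ i ∈ s, f i) (∑ i ∈ s, g i) := by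
  classical
  induction s using Finset.induction_on with
  | empty => exact .zero
  | insert a s ha ih =>
    rw [Finset.sum_insert ha, Finset.sum_insert ha]
    exact (h a (by simp)).add (ih fun i hi => h i (by simp [hi]))

end Wiener

theorem card_triads_le (j : ℤ) : (triads j).card ≤ 64 :=
  (Finset.card_filter_le _ _).trans (by decide)

namespace HypSystem

variable {d n : ℕ} (Q : HypSystem d n)

/-- The polarized nonlinearity `∑_{j₁+j₂+j₃=j} T(·, ·, ·)` on triples of pairs `(u₁, u₃)`; the
right-hand side of the envelope equation is its value on the diagonal. -/
noncomputable def nonlinForm (j : ℤ) :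
    ContinuousMultilinearMap ℝ (fun _ : Fin 3 => Wiener d n × Wiener d n) (Wiener d n) :=
  ∑ J ∈ triads j, (Q.triW.restrictScalars ℝ).compContinuousLinearMap fun i =>
    Wiener.modeL (![J.1, J.2.1, J.2.2] i)

theorem nonlinForm_apply (j : ℤ) (m : Fin 3 → Wiener d n × Wiener d n) :
    Q.nonlinForm j m
      = ∑ J ∈ triads j, Q.triW fun i => Wiener.modeL (![J.1, J.2.1, J.2.2] i) (m i) := by
  simp [nonlinForm, sum_apply]

theorem norm_nonlinForm_le {CT : ℝ} (h0 : 0 ≤ CT)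
    (hT : ∀ a b c : Cn n, ‖Q.TC a b c‖ ≤ CT * ‖a‖ * ‖b‖ * ‖c‖) (j : ℤ) :
    ‖Q.nonlinForm (d := d) j‖ ≤ 64 * (Wiener.evalConst d ^ 2 * CT) := by
  have hsummand : ∀ J ∈ triads j, ‖(Q.triW (d := d).restrictScalars ℝ).compContinuousLinearMap
      fun i => Wiener.modeL (![J.1, J.2.1, J.2.2] i)‖ ≤ Wiener.evalConst d ^ 2 * CT := by
    intro J _
    refine (ContinuousMultilinearMap.norm_compContinuousLinearMap_le _ _).trans ?_
    rw [ContinuousMultilinearMap.norm_restrictScalars]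
    exact (mul_le_of_le_one_right (norm_nonneg _) (Finset.prod_le_one (fun _ _ => norm_nonneg _)
      fun _ _ => Wiener.norm_modeL_le _)).trans (Q.norm_triW_le h0 hT)
  refine (norm_sum_le_of_le _ hsummand).trans ?_
  rw [Finset.sum_const, nsmul_eq_mul]
  gcongr
  exact_mod_cast card_triads_le j

theorem eval_nonlinForm (j : ℤ) (U : Wiener d n × Wiener d n) (x : Rd d) :
    Wiener.eval (Q.nonlinForm j fun _ => U) x
      = ∑ J ∈ triads j, Q.TC (modeVal U.1 U.2 J.1 x) (modeVal U.1 U.2 J.2.1 x)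
          (modeVal U.1 U.2 J.2.2 x) := by
  rw [nonlinForm_apply, ← Wiener.evalₗ_apply, map_sum]
  simp [Wiener.evalₗ_apply, eval_triW, Wiener.eval_modeL]

end HypSystem

theorem Wiener.HasFourierPartial.nonlinForm {d n : ℕ} (Q : HypSystem d n) {l : Fin d}
    {U U' : Wiener d n × Wiener d n} (h₁ : HasFourierPartial l U.1 U'.1)
    (h₃ : HasFourierPartial l U.2 U'.2) (j : ℤ) :
    HasFourierPartial l (Q.nonlinForm j fun _ => U)
      ((Q.nonlinForm j).linearDeriv (fun _ => U) fun _ => U') := by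
  rw [ContinuousMultilinearMap.linearDeriv_apply]
  simp only [HypSystem.nonlinForm_apply]
  rw [Finset.sum_comm]
  refine .sum _ fun J _ => ?_
  have := HasFourierPartial.triW Q fun i => h₁.modeL h₃ (![J.1, J.2.1, J.2.2] i)
  rw [ContinuousMultilinearMap.linearDeriv_apply] at this
  refine Eq.mp (congrArg _ (Finset.sum_congr rfl fun i _ => congrArg _ ?_)) this
  funext k
  exact (Function.apply_update (fun k => Wiener.modeL (![J.1, J.2.1, J.2.2] k))
    (fun _ => U) i U' k).symm

/-! ### Propagation of `W¹` bounds -/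

section TransportPartial

theorem norm_le_of_forall_setIntegral_le {α E : Type*} [NormedAddCommGroup E]
    {m : MeasurableSpace α} {μ : Measure α} {s : ℕ → Set α} (hs : AECover μ Filter.atTop s)
    {f : Lp E 1 μ} {C : ℝ} (h : ∀ N, ∫ k in s N, ‖f k‖ ∂μ ≤ C) : ‖f‖ ≤ C := by
  rw [L1.norm_eq_integral_norm]
  exact le_of_tendsto' (hs.integral_tendsto_of_countably_generated (L1.integrable_coeFn f).norm) h

variable {d n : ℕ}

theorem aecover_abs_coord_le (l : Fin d) :
    AECover (volume : Measure (Rd d)) Filter.atTop fun N : ℕ => {k : Rd d | |k l| ≤ N} where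
  ae_eventually_mem := .of_forall fun k =>
    Filter.tendsto_atTop.1 tendsto_natCast_atTop_atTop |k l|
  measurableSet N := measurableSet_le (by fun_prop) measurable_const

/-- The symbol `i k_l` of `∂_l`, cut off to `|k_l| ≤ N` in order to be bounded. -/
noncomputable def truncatedPartial (n : ℕ) (l : Fin d) (N : ℕ) (k : Rd d) : Cn n →L[ℂ] Cn n :=
  {k : Rd d | |k l| ≤ N}.indicator (fun k => I * (k l : ℂ)) k • ContinuousLinearMap.id ℂ (Cn n)

theorem memLp_truncatedPartial (l : Fin d) (N : ℕ) :
    MemLp (truncatedPartial n l N) ∞ (volume : Measure (Rd d)) := by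
  have hmeas : AEStronglyMeasurable
      ({k : Rd d | |k l| ≤ N}.indicator fun k => I * (k l : ℂ)) volume :=
    (by fun_prop : Continuous fun k : Rd d => I * (k l : ℂ)).aestronglyMeasurable.indicator
      ((aecover_abs_coord_le l).measurableSet N)
  refine memLp_top_of_bound (hmeas.smul_const _) N (.of_forall fun k => ?_)
  rw [truncatedPartial, norm_smul]
  refine (mul_le_of_le_one_right (norm_nonneg _) ContinuousLinearMap.norm_id_le).trans ?_
  by_cases hk : |k l| ≤ N <;> simp [hk]

namespace Wiener.HasFourierPartial

variable {l : Fin d} {f f' : Wiener d n}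

theorem norm_mulL1_truncatedPartial_le (h : HasFourierPartial l f f') (N : ℕ) :
    ‖mulL1 (memLp_truncatedPartial l N) f‖ ≤ ‖f'‖ := by
  refine Lp.norm_le_norm_of_ae_le ?_
  filter_upwards [coeFn_mulL1 (memLp_truncatedPartial l N) f, h] with k h1 h2
  rw [h1, h2]
  by_cases hk : |k l| ≤ N <;> simp [truncatedPartial, hk]

theorem norm_le_of_forall_mulL1_truncatedPartial (h : HasFourierPartial l f f') {C : ℝ}
    (hC : ∀ N, ‖mulL1 (memLp_truncatedPartial l N) f‖ ≤ C) : ‖f'‖ ≤ C := by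
  refine norm_le_of_forall_setIntegral_le (aecover_abs_coord_le l) fun N => ?_
  rw [← integral_indicator ((aecover_abs_coord_le l).measurableSet N)]
  refine (integral_congr_ae ?_).trans_le ((L1.norm_eq_integral_norm _).ge.trans (hC N))
  filter_upwards [coeFn_mulL1 (memLp_truncatedPartial l N) f, h] with k h1 h2
  rw [h1]
  by_cases hk : |k l| ≤ N <;> simp [truncatedPartial, hk, h2]

end Wiener.HasFourierPartial

-- The derivatives `a'` and `b` of `a` in time and space need not commute in `L¹`, so the equation
-- is multiplied by the cut-off symbol of `∂_l` instead of being differentiated.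
theorem IsTransport.norm_partial_le {H : Rd d → Cn n →ₗ[ℂ] Cn n} (hH : ∀ k, (H k).IsSymmetric)
    {τ c : ℝ} {a a' f b g : ℝ → Wiener d n} {l : Fin d} (ha : IsTransport H τ a a' f)
    (hb : ∀ t ∈ Icc 0 τ, Wiener.HasFourierPartial l (a t) (b t))
    (hg : ∀ t ∈ Ioc 0 τ, Wiener.HasFourierPartial l (f t) (g t))
    (hc : ∀ t ∈ Ioc 0 τ, ‖g t‖ ≤ c) : ∀ t ∈ Icc 0 τ, ‖b t‖ ≤ ‖b 0‖ + c * t := by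
  intro t ht
  refine (hb t ht).norm_le_of_forall_mulL1_truncatedPartial fun N => ?_
  have htrunc := ha.map_mulL1 (memLp_truncatedPartial l N)
    (by simp [truncatedPartial])
  refine (htrunc.norm_le hH
    (fun s hs => ((hg s hs).norm_mulL1_truncatedPartial_le N).trans (hc s hs)) t ht).trans ?_
  gcongr
  exact (hb 0 ⟨le_rfl, ht.1.trans ht.2⟩).norm_mulL1_truncatedPartial_le N

end TransportPartial

/-! ### The envelope equation in Fourier space -/

namespace HypSystem

variable {d n : ℕ} (Q : HypSystem d n)

theorem L_isHermitian (α : ℝ) (β : Rd d) : (Q.L α β).IsHermitian := by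
  have hA : ∀ l i j, Q.A l j i = Q.A l i j := fun l i j => (Q.A_symm l).apply i j
  have hE : ∀ i j, Q.E j i = -Q.E i j := fun i j => congrFun (congrFun Q.E_skew i) j
  ext i j
  simp only [L, Matrix.conjTranspose_apply, Matrix.sub_apply, Matrix.add_apply, Matrix.smul_apply,
    Matrix.sum_apply, Matrix.map_apply, hA _ i j, hE i j, Matrix.one_apply, eq_comm (a := j)]
  simp [apply_ite (starRingEnd ℂ), sub_eq_add_neg]

/-- The Hamiltonian `ε⁻¹ L(jω, jκ + εk)`, by which the linear part of the envelope equation for the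
mode `u_j` acts at the frequency `k`. -/
noncomputable def hamiltonian (κ : Rd d) (ω ε : ℝ) (j : ℕ) (k : Rd d) : Cn n →ₗ[ℂ] Cn n :=
  (ε : ℂ)⁻¹ • Matrix.toEuclideanLin (Q.L (j * ω) ((j : ℝ) • κ + ε • k))

theorem hamiltonian_isSymmetric (κ : Rd d) (ω ε : ℝ) (j : ℕ) (k : Rd d) :
    (Q.hamiltonian κ ω ε j k).IsSymmetric :=
  (Matrix.isSymmetric_toEuclideanLin_iff.2 (Q.L_isHermitian _ _)).smul (by simp)

/-- The symbol `A(β) = ∑ β_l A_l`. -/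
noncomputable def symbolA (β : Rd d) : Cn n →ₗ[ℂ] Cn n :=
  ∑ l, (β l : ℂ) • Matrix.toEuclideanLin ((Q.A l).map ofReal)

theorem symbolA_apply (β : Rd d) (v : Cn n) :
    Q.symbolA β v = ∑ l, (β l : ℂ) • Matrix.toEuclideanLin ((Q.A l).map ofReal) v := by
  simp [symbolA]

theorem symbolA_smul (s : ℝ) (β : Rd d) : Q.symbolA (s • β) = (s : ℂ) • Q.symbolA β := by
  simp only [symbolA, Finset.smul_sum, smul_smul, PiLp.smul_apply, smul_eq_mul, ofReal_mul]

theorem toEuclideanLin_L_add (α : ℝ) (β γ : Rd d) :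
    Matrix.toEuclideanLin (Q.L α (β + γ)) = Matrix.toEuclideanLin (Q.L α β) + Q.symbolA γ := by
  have h : Q.L α (β + γ) = Q.L α β + ∑ l, (γ l : ℂ) • (Q.A l).map ofReal := by
    simp only [L, PiLp.add_apply, ofReal_add, add_smul, Finset.sum_add_distrib]
    abel
  simp only [h, map_add, map_sum, map_smul, symbolA]

theorem toEuclideanLin_L_eq_sub (α : ℝ) (β : Rd d) (v : Cn n) :
    Matrix.toEuclideanLin (Q.L α β) v = Matrix.toEuclideanLin (Q.L 0 β) v - (α : ℂ) • v := by
  have h : Q.L α β = Q.L 0 β - (α : ℂ) • 1 := by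
    simp only [L, ofReal_zero, neg_zero, zero_smul, neg_smul]
    abel
  simp only [h, map_sub, map_smul, LinearMap.sub_apply, LinearMap.smul_apply,
    Matrix.toLpLin_one, LinearMap.id_apply]

theorem hamiltonian_eq_add {ε : ℝ} (hε : ε ≠ 0) (κ : Rd d) (ω : ℝ) (j : ℕ) (k : Rd d) (v : Cn n) :
    Q.hamiltonian κ ω ε j k v
      = (ε : ℂ)⁻¹ • Matrix.toEuclideanLin (Q.L (j * ω) ((j : ℝ) • κ)) v + Q.symbolA k v := by
  rw [hamiltonian, toEuclideanLin_L_add, symbolA_smul, smul_add, smul_smul,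
    inv_mul_cancel₀ (ofReal_ne_zero.2 hε), one_smul]
  rfl

variable {Q}

theorem aestronglyMeasurable_hamiltonian {ε : ℝ} (hε : ε ≠ 0) {κ : Rd d} {ω : ℝ} {j : ℕ}
    {f : Rd d → Cn n} (hf : AEStronglyMeasurable f) :
    AEStronglyMeasurable fun k => Q.hamiltonian κ ω ε j k (f k) := by
  have hlin : ∀ T : Cn n →ₗ[ℂ] Cn n, AEStronglyMeasurable fun k => T (f k) := fun T =>
    T.continuous_of_finiteDimensional.comp_aestronglyMeasurable hf
  have hcoord : ∀ l, AEStronglyMeasurable fun k : Rd d => (k l : ℂ) := fun l =>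
    (by fun_prop : Continuous fun k : Rd d => (k l : ℂ)).aestronglyMeasurable
  have hA : AEStronglyMeasurable fun k => Q.symbolA k (f k) := by
    simp only [Q.symbolA_apply]
    exact Finset.aestronglyMeasurable_fun_sum _ fun l _ => (hcoord l).smul (hlin _)
  have hL := (hlin (Matrix.toEuclideanLin (Q.L (j * ω) ((j : ℝ) • κ)))).const_smul (ε : ℂ)⁻¹
  simp only [Q.hamiltonian_eq_add hε]
  exact hL.add hA

end HypSystem

section FourierEquation

variable {d n : ℕ} {Q : HypSystem d n} {κ : Rd d} {ω ε : ℝ}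

theorem EnvelopeEq.ae_eq (hε : ε ≠ 0) {u₁ u₃ w w' : Wiener d n} {j : ℕ} (hw : Wiener.MemW1 w)
    (h : ∀ x, EnvelopeEq Q κ ω ε u₁ u₃ j w w' x) :
    ∀ᵐ k : Rd d, w' k = -(I • Q.hamiltonian κ ω ε j k (w k))
      + ((ε : ℂ) • Q.nonlinForm j fun _ => (u₁, u₃) : Wiener d n) k := by
  let L : Cn n →L[ℂ] Cn n :=
    (Matrix.toEuclideanLin (Q.L (j * ω) ((j : ℝ) • κ))).toContinuousLinearMap
  let A : Fin d → Cn n →L[ℂ] Cn n := fun l =>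
    (Matrix.toEuclideanLin ((Q.A l).map ofReal)).toContinuousLinearMap
  have key : w' + (I / ε) • L.compLp w + ∑ l, (A l).compLp (Wiener.partialD l w)
      = (ε : ℂ) • Q.nonlinForm j fun _ => (u₁, u₃) := by
    refine Wiener.eq_of_eval_eq fun x => ?_
    have hx := h x
    simp only [EnvelopeEq, hw.lineDeriv_eval, ← Q.eval_nonlinForm j (u₁, u₃),
      Int.cast_natCast] at hx
    simp only [← Wiener.evalₗ_apply, map_add, map_smul, map_sum]
    simp only [Wiener.evalₗ_apply, Wiener.eval_compLp]
    exact hx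
  have hA : ∀ᵐ k : Rd d, ∀ l, (A l).compLp (Wiener.partialD l w) k = A l (Wiener.partialD l w k) :=
    ae_all_iff.2 fun l => (A l).coeFn_compLp _
  rw [← key]
  filter_upwards [Lp.coeFn_finsetSum Finset.univ fun l => (A l).compLp (Wiener.partialD l w), hA,
    ae_all_iff.2 fun l => hw.hasFourierPartial l, L.coeFn_compLp w,
    Lp.coeFn_add (w' + (I / ε) • L.compLp w) (∑ l, (A l).compLp (Wiener.partialD l w)),
    Lp.coeFn_add w' ((I / ε) • L.compLp w), Lp.coeFn_smul (I / ε) (L.compLp w)]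
    with k h1 h2 h3 h4 h5 h6 h7
  have hsymbol : I • Q.symbolA k (w k) = ∑ l, A l (Wiener.partialD l w k) := by
    simp only [HypSystem.symbolA_apply, Finset.smul_sum, h3, map_smul, mul_smul]
    rfl
  rw [h5, Pi.add_apply, h6, Pi.add_apply, h7, Pi.smul_apply, h4, h1, Finset.sum_apply,
    Finset.sum_congr rfl fun l _ => h2 l, ← hsymbol, Q.hamiltonian_eq_add hε, smul_add, smul_smul,
    div_eq_mul_inv]
  change _ = -(_ • L (w k) + _) + _
  abel

end FourierEquation

section CubicMap

variable {V G : Type*} [NormedAddCommGroup V] [NormedSpace ℝ V] [NormedAddCommGroup G]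
  [NormedSpace ℝ G] {N : ContinuousMultilinearMap ℝ (fun _ : Fin 3 => V) G} {C B : ℝ} {U U' : V}

theorem norm_cubic_le (hN : ‖N‖ ≤ C) (hU : ‖U‖ ≤ B) : ‖N fun _ => U‖ ≤ C * B ^ 3 := by
  simpa using N.le_mul_prod_of_opNorm_le_of_le hN fun _ => hU

theorem norm_cubic_linearDeriv_le (hN : ‖N‖ ≤ C) (hU : ‖U‖ ≤ B) :
    ‖N.linearDeriv (fun _ => U) fun _ => U'‖ ≤ 3 * C * B ^ 2 * ‖U'‖ := by
  have hC : 0 ≤ C := (norm_nonneg N).trans hN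
  calc ‖N.linearDeriv (fun _ => U) fun _ => U'‖
      ≤ ‖N‖ * 3 * ‖fun _ : Fin 3 => U‖ ^ 2 * ‖fun _ : Fin 3 => U'‖ := by
        simpa using norm_linearDeriv_le N (fun _ => U) fun _ => U'
    _ ≤ C * 3 * B ^ 2 * ‖U'‖ := by
        gcongr
        exacts [(pi_norm_const_le U).trans hU, pi_norm_const_le U']
    _ = 3 * C * B ^ 2 * ‖U'‖ := by ring

theorem norm_cubic_sub_le (hN : ‖N‖ ≤ C) (hU : ‖U‖ ≤ B) (hU' : ‖U'‖ ≤ B) :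
    ‖(N fun _ => U) - N fun _ => U'‖ ≤ 3 * C * B ^ 2 * ‖U - U'‖ := by
  have hC : 0 ≤ C := (norm_nonneg N).trans hN
  calc ‖(N fun _ => U) - N fun _ => U'‖
      ≤ ‖N‖ * 3 * max ‖fun _ : Fin 3 => U‖ ‖fun _ : Fin 3 => U'‖ ^ 2
          * ‖fun _ : Fin 3 => U - U'‖ := by
        simpa [Pi.sub_def] using N.norm_image_sub_le (fun _ => U) fun _ => U'
    _ ≤ C * 3 * B ^ 2 * ‖U - U'‖ := by
        gcongr
        exacts [max_le ((pi_norm_const_le U).trans hU) ((pi_norm_const_le U').trans hU'),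
          pi_norm_const_le _]
    _ = 3 * C * B ^ 2 * ‖U - U'‖ := by ring

theorem hasDerivWithinAt_cubic {u : ℝ → V} {s : Set ℝ} {t : ℝ} (h : HasDerivWithinAt u U' s t) :
    HasDerivWithinAt (fun t => N fun _ => u t)
      (N.linearDeriv (fun _ => u t) fun _ => U') s t :=
  (N.hasFDerivAt fun _ => u t).comp_hasDerivWithinAt t (hasDerivWithinAt_pi.2 fun _ => h)

end CubicMap

section Propagation

variable {d n : ℕ} {Q : HypSystem d n} {κ : Rd d} {ω ε τ : ℝ} {p : Wiener d n}
  {u₁ u₃ : ℝ → Wiener d n}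

theorem Wiener.normW1_zero (h : MemW1 (0 : Wiener d n)) : normW1 (0 : Wiener d n) = 0 := by
  have hpartial : ∀ l, partialD l (0 : Wiener d n) = 0 := fun l => by
    rw [Lp.eq_zero_iff_ae_eq_zero]
    filter_upwards [h.hasFourierPartial l, Lp.coeFn_zero (Cn n) 1 (volume : Measure (Rd d))]
      with k h1 h2
    rw [h1, h2, Pi.zero_apply, smul_zero]
  simp [normW1, hpartial]

theorem Wiener.norm_prod_le {f g : Wiener d n} {B : ℝ} (h : normW1 f + normW1 g ≤ B) :
    ‖(f, g)‖ ≤ B :=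
  max_le (by linarith [norm_le_normW1 f, normW1_nonneg g])
    (by linarith [norm_le_normW1 g, normW1_nonneg f])

theorem Wiener.norm_partialD_prod_le {f g : Wiener d n} {B : ℝ} (h : normW1 f + normW1 g ≤ B)
    (l : Fin d) : ‖(partialD l f, partialD l g)‖ ≤ B :=
  max_le (by linarith [norm_partialD_le_normW1 f l, normW1_nonneg g])
    (by linarith [norm_partialD_le_normW1 g l, normW1_nonneg f])

theorem Wiener.MemW1.hasFourierPartial_nonlinForm {f g : Wiener d n} (hf : MemW1 f)
    (Q : HypSystem d n) (hg : MemW1 g) (l : Fin d) (j : ℤ) :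
    HasFourierPartial l (Q.nonlinForm j fun _ => (f, g)) ((Q.nonlinForm j).linearDeriv
      (fun _ => (f, g)) fun _ => (partialD l f, partialD l g)) :=
  HasFourierPartial.nonlinForm Q (U := (f, g)) (U' := (partialD l f, partialD l g))
    (hf.hasFourierPartial l) (hg.hasFourierPartial l) j

theorem ClassicalRegularity.continuousOn_normW1 {w : ℝ → Wiener d n}
    (h : ClassicalRegularity τ w) : ContinuousOn (fun t => Wiener.normW1 (w t)) (Icc 0 τ) :=
  h.contDiffOn.continuousOn.norm.add
    (continuousOn_finsetSum _ fun l _ => (h.continuousOn_partial l).norm)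

theorem IsTransport.normW1_le {H : Rd d → Cn n →ₗ[ℂ] Cn n} (hH : ∀ k, (H k).IsSymmetric)
    {a a' f : ℝ → Wiener d n} {g : ℝ → Fin d → Wiener d n} {c c' : ℝ}
    (ha : IsTransport H τ a a' f) (hmem : ∀ t ∈ Icc 0 τ, Wiener.MemW1 (a t))
    (hf : ∀ t ∈ Ioc 0 τ, ‖f t‖ ≤ c)
    (hg : ∀ t ∈ Ioc 0 τ, ∀ l, Wiener.HasFourierPartial l (f t) (g t l))
    (hc : ∀ t ∈ Ioc 0 τ, ∀ l, ‖g t l‖ ≤ c') :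
    ∀ t ∈ Icc 0 τ, Wiener.normW1 (a t) ≤ Wiener.normW1 (a 0) + (c + d * c') * t := by
  intro t ht
  have hpartial : ∀ l, ‖Wiener.partialD l (a t)‖ ≤ ‖Wiener.partialD l (a 0)‖ + c' * t := fun l =>
    ha.norm_partial_le hH (fun s hs => (hmem s hs).hasFourierPartial l) (fun s hs => hg s hs l)
      (fun s hs => hc s hs l) t ht
  calc Wiener.normW1 (a t)
      ≤ (‖a 0‖ + c * t) + ∑ l, (‖Wiener.partialD l (a 0)‖ + c' * t) := by
        rw [Wiener.normW1]
        gcongr with l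
        exacts [ha.norm_le hH hf t ht, hpartial l]
    _ = Wiener.normW1 (a 0) + (c + d * c') * t := by
        rw [Finset.sum_add_distrib, Finset.sum_const, Finset.card_univ, Fintype.card_fin,
          nsmul_eq_mul, Wiener.normW1]
        ring

theorem ClassicalRegularity.isTransport {w : ℝ → Wiener d n} (hw : ClassicalRegularity τ w)
    (hε : ε ≠ 0) {j : ℕ} (h : ∀ t ∈ Ioc 0 τ, ∀ x,
      EnvelopeEq Q κ ω ε (u₁ t) (u₃ t) j (w t) (derivWithin w (Icc 0 τ) t) x) :
    IsTransport (Q.hamiltonian κ ω ε j) τ w (derivWithin w (Icc 0 τ))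
      (fun t => (ε : ℂ) • Q.nonlinForm j fun _ => (u₁ t, u₃ t)) where
  continuousOn := hw.contDiffOn.continuousOn
  hasDerivWithinAt t ht :=
    (hw.contDiffOn.differentiableOn one_ne_zero t (Ioc_subset_Icc_self ht)).hasDerivWithinAt
  ae_eq t ht := EnvelopeEq.ae_eq hε (hw.memW1 t (Ioc_subset_Icc_self ht)) (h t ht)

namespace IsClassicalSolution

variable {C B : ℝ}

theorem isTransport₁ (h : IsClassicalSolution Q κ ω ε τ p u₁ u₃) (hε : ε ≠ 0) :
    IsTransport (Q.hamiltonian κ ω ε 1) τ u₁ (derivWithin u₁ (Icc 0 τ))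
      (fun t => (ε : ℂ) • Q.nonlinForm 1 fun _ => (u₁ t, u₃ t)) :=
  h.regular₁.isTransport (j := 1) hε h.eq₁

theorem isTransport₃ (h : IsClassicalSolution Q κ ω ε τ p u₁ u₃) (hε : ε ≠ 0) :
    IsTransport (Q.hamiltonian κ ω ε 3) τ u₃ (derivWithin u₃ (Icc 0 τ))
      (fun t => (ε : ℂ) • Q.nonlinForm 3 fun _ => (u₁ t, u₃ t)) :=
  h.regular₃.isTransport (j := 3) hε h.eq₃

theorem normW1_mode_le (h : IsClassicalSolution Q κ ω ε τ p u₁ u₃) (hε : 0 < ε) {j : ℕ}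
    (hC : ‖Q.nonlinForm (d := d) j‖ ≤ C) {w w' : ℝ → Wiener d n}
    (hw : IsTransport (Q.hamiltonian κ ω ε j) τ w w'
      fun t => (ε : ℂ) • Q.nonlinForm j fun _ => (u₁ t, u₃ t))
    (hmem : ∀ t ∈ Icc 0 τ, Wiener.MemW1 (w t)) {T : ℝ} (hT : T ∈ Icc 0 τ)
    (hB : ∀ t ∈ Icc 0 T, Wiener.normW1 (u₁ t) + Wiener.normW1 (u₃ t) ≤ B) :
    Wiener.normW1 (w T) ≤ Wiener.normW1 (w 0) + (3 * d + 1) * C * B ^ 3 * (ε * T) := by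
  have hsub : Ioc 0 T ⊆ Icc 0 τ := Ioc_subset_Icc_self.trans (Icc_subset_Icc_right hT.2)
  have hnorm : ‖(ε : ℂ)‖ = ε := Complex.norm_of_nonneg hε.le
  have hC0 : 0 ≤ C := (norm_nonneg _).trans hC
  have : 0 ≤ B := (norm_nonneg _).trans (Wiener.norm_prod_le (hB 0 ⟨le_rfl, hT.1⟩))
  let g : ℝ → Fin d → Wiener d n := fun t l => (Q.nonlinForm j).linearDeriv
    (fun _ => (u₁ t, u₃ t)) fun _ => (Wiener.partialD l (u₁ t), Wiener.partialD l (u₃ t))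
  have hf : ∀ t ∈ Ioc 0 T, ‖(ε : ℂ) • Q.nonlinForm j fun _ => (u₁ t, u₃ t)‖
      ≤ ε * (C * B ^ 3) := fun t ht => by
    rw [norm_smul, hnorm]
    gcongr
    exact norm_cubic_le hC (Wiener.norm_prod_le (hB t (Ioc_subset_Icc_self ht)))
  have hg : ∀ t ∈ Ioc 0 T, ∀ l, ‖(ε : ℂ) • g t l‖ ≤ ε * (3 * C * B ^ 3) := fun t ht l => by
    have hBt := hB t (Ioc_subset_Icc_self ht)
    rw [norm_smul, hnorm, pow_succ, ← mul_assoc (3 * C)]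
    gcongr
    calc ‖g t l‖ ≤ 3 * C * B ^ 2 * ‖(Wiener.partialD l (u₁ t), Wiener.partialD l (u₃ t))‖ :=
          norm_cubic_linearDeriv_le hC (Wiener.norm_prod_le hBt)
      _ ≤ 3 * C * B ^ 2 * B := by gcongr; exact Wiener.norm_partialD_prod_le hBt l
  have hpartial : ∀ t ∈ Ioc 0 T, ∀ l, Wiener.HasFourierPartial l
      ((ε : ℂ) • Q.nonlinForm j fun _ => (u₁ t, u₃ t)) ((ε : ℂ) • g t l) := fun t ht l =>
    ((h.regular₁.memW1 t (hsub ht)).hasFourierPartial_nonlinForm Q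
      (h.regular₃.memW1 t (hsub ht)) l j).const_smul (ε : ℂ)
  have key := (hw.mono hT.2).normW1_le (Q.hamiltonian_isSymmetric κ ω ε j)
    (fun t ht => hmem t (Icc_subset_Icc_right hT.2 ht)) hf hpartial hg T ⟨hT.1, le_rfl⟩
  calc Wiener.normW1 (w T) ≤ _ := key
    _ = _ := by ring

theorem normW1_lt (h : IsClassicalSolution Q κ ω ε τ p u₁ u₃) (hε : 0 < ε) (hB : 0 ≤ B)
    (hC : ∀ j, ‖Q.nonlinForm (d := d) j‖ ≤ C) {T : ℝ} (hT : T ∈ Icc 0 τ)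
    (hsmall : Wiener.normW1 p + 2 * ((3 * d + 1) * C * B ^ 3 * (ε * T)) < B) :
    ∀ t ∈ Icc 0 T, Wiener.normW1 (u₁ t) + Wiener.normW1 (u₃ t) < B := by
  have hsub : Icc 0 T ⊆ Icc 0 τ := Icc_subset_Icc_right hT.2
  have hC0 : 0 ≤ C := (norm_nonneg _).trans (hC 1)
  have hmono : ∀ t ∈ Icc 0 T, Wiener.normW1 (u₁ 0) + Wiener.normW1 (u₃ 0)
      + 2 * ((3 * d + 1) * C * B ^ 3 * (ε * t)) < B := fun t ht => by
    refine lt_of_le_of_lt ?_ hsmall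
    have hzero := Wiener.normW1_zero (h.init₃ ▸ h.regular₃.memW1 0 (hsub ⟨le_rfl, hT.1⟩))
    rw [h.init₁, h.init₃, hzero, add_zero]
    gcongr
    exact ht.2
  refine lt_of_bootstrap ((h.regular₁.continuousOn_normW1.add
    h.regular₃.continuousOn_normW1).mono hsub) ?_ fun t ht hBt => ?_
  · simpa using hmono 0 ⟨le_rfl, hT.1⟩
  · have h₁ := h.normW1_mode_le hε (hC _) (h.isTransport₁ hε.ne') h.regular₁.memW1 (hsub ht) hBt
    have h₃ := h.normW1_mode_le hε (hC _) (h.isTransport₃ hε.ne') h.regular₃.memW1 (hsub ht) hBt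
    linarith [hmono t ht]

end IsClassicalSolution

end Propagation

/-! ### The spectral multipliers of the envelope system -/

theorem le_of_forall_pos_mul_le_add_mul {x y a : ℝ} (h : ∀ s : ℝ, 0 < s → s * x ≤ a + s * y) :
    x ≤ y := by
  have hlim : Filter.Tendsto (fun s : ℝ => a / s + y) Filter.atTop (nhds (0 + y)) :=
    (Filter.tendsto_id.const_div_atTop a).add_const y
  rw [zero_add] at hlim
  refine ge_of_tendsto hlim ?_
  filter_upwards [Filter.eventually_gt_atTop 0] with s hs
  rw [div_add' _ _ _ hs.ne', le_div_iff₀ hs]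
  linarith [h s hs]

/-- An orthonormal eigendecomposition `L(0, β) ψ_ℓ(β) = λ_ℓ(β) ψ_ℓ(β)` depending measurably on `β`,
whose eigenvalues are Lipschitz with constant `K` with respect to `|·|₁`. -/
structure MeasurableEigendecomposition {d n : ℕ} (Q : HypSystem d n) (K : ℝ)
    (lam : Fin n → Rd d → ℝ) (psi : Fin n → Rd d → Cn n) : Prop where
  eigen : ∀ ℓ β, Matrix.toEuclideanLin (Q.L 0 β) (psi ℓ β) = (lam ℓ β : ℂ) • psi ℓ β
  orthonormal : ∀ β, Orthonormal ℂ fun ℓ => psi ℓ β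
  measurable_psi : ∀ ℓ, Measurable (psi ℓ)
  lipschitz : ∀ ℓ β β', |lam ℓ β' - lam ℓ β| ≤ K * ∑ l, |β' l - β l|

theorem SmoothEigendecomposition.measurableEigendecomposition {d n : ℕ} {Q : HypSystem d n} {K : ℝ}
    {lam : Fin n → Rd d → ℝ} {psi : Fin n → Rd d → Cn n}
    (h : SmoothEigendecomposition Q K lam psi) : MeasurableEigendecomposition Q K lam psi where
  eigen := h.eigen
  orthonormal := h.orthonormal
  measurable_psi ℓ := measurable_of_continuousOn_compl_singleton 0 (h.smooth_psi ℓ).continuousOn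
  lipschitz := h.lipschitz

/-- The eigenvalues `λ_{jℓ}(0)` of `L(jω, jκ)`, as complex coefficients. The resonant indices are
those with value `0`, so `lamZero * lamZero⁻¹` is the indicator function of the nonresonant ones. -/
noncomputable def lamZero {d n : ℕ} (κ : Rd d) (ω : ℝ) (lam : Fin n → Rd d → ℝ) (j : ℕ) :
    Fin n → ℂ := fun ℓ => lamJ κ ω lam j ℓ 0

namespace MeasurableEigendecomposition

section Spectral

variable {d n : ℕ} {Q : HypSystem d n} {K : ℝ} {lam : Fin n → Rd d → ℝ}
  {psi : Fin n → Rd d → Cn n}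

theorem mono (hS : MeasurableEigendecomposition Q K lam psi) {K' : ℝ} (h : K ≤ K') :
    MeasurableEigendecomposition Q K' lam psi where
  eigen := hS.eigen
  orthonormal := hS.orthonormal
  measurable_psi := hS.measurable_psi
  lipschitz ℓ β β' := (hS.lipschitz ℓ β β').trans (by gcongr)

theorem toEuclideanLin_L_psi (hS : MeasurableEigendecomposition Q K lam psi) (α : ℝ) (β : Rd d)
    (ℓ : Fin n) :
    Matrix.toEuclideanLin (Q.L α β) (psi ℓ β) = ((lam ℓ β - α : ℝ) : ℂ) • psi ℓ β := by
  rw [Q.toEuclideanLin_L_eq_sub, hS.eigen, ← sub_smul, ofReal_sub]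

theorem toEuclideanLin_L_eq_spectralMap (hS : MeasurableEigendecomposition Q K lam psi) (α : ℝ)
    (β : Rd d) (v : Cn n) : Matrix.toEuclideanLin (Q.L α β) v
      = spectralMap ℂ (fun ℓ => psi ℓ β) (fun ℓ => ((lam ℓ β - α : ℝ) : ℂ)) v :=
  map_eq_spectralMap (hS.orthonormal β) (by simp) (hS.toEuclideanLin_L_psi α β) v

theorem norm_symbolA_le (hS : MeasurableEigendecomposition Q K lam psi) (hK : 0 ≤ K) (β : Rd d)
    (v : Cn n) : ‖Q.symbolA β v‖ ≤ K * (∑ l, |β l|) * ‖v‖ := by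
  set Λ := ∑ ℓ, |lam ℓ 0|
  have hΛ : ∀ ℓ, |lam ℓ 0| ≤ Λ := fun ℓ =>
    Finset.single_le_sum (f := fun ℓ => |lam ℓ 0|) (fun _ _ => abs_nonneg _) (Finset.mem_univ ℓ)
  have : 0 ≤ Λ := Finset.sum_nonneg fun _ _ => abs_nonneg _
  have hL : ∀ s : ℝ, 0 ≤ s → ‖Matrix.toEuclideanLin (Q.L 0 (s • β)) v‖
      ≤ (Λ + s * (K * ∑ l, |β l|)) * ‖v‖ := fun s hs => by
    rw [hS.toEuclideanLin_L_eq_spectralMap]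
    refine norm_spectralMap_le (hS.orthonormal _) (by positivity) (fun ℓ => ?_) v
    have hsum : ∑ l, |(s • β) l - (0 : Rd d) l| = s * ∑ l, |β l| := by
      simp [Finset.mul_sum, abs_mul, abs_of_nonneg hs]
    have hlip := hS.lipschitz ℓ 0 (s • β)
    rw [sub_zero, norm_real, Real.norm_eq_abs]
    rw [hsum] at hlip
    linarith [abs_sub_abs_le_abs_sub (lam ℓ (s • β)) (lam ℓ 0), hΛ ℓ]
  refine le_of_forall_pos_mul_le_add_mul (a := 2 * Λ * ‖v‖) fun s hs => ?_
  have hsub : (s : ℂ) • Q.symbolA β v = Matrix.toEuclideanLin (Q.L 0 (s • β)) v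
      - Matrix.toEuclideanLin (Q.L 0 ((0 : ℝ) • β)) v := by
    rw [zero_smul, ← zero_add (s • β), Q.toEuclideanLin_L_add, Q.symbolA_smul]
    simp
  calc s * ‖Q.symbolA β v‖ = ‖(s : ℂ) • Q.symbolA β v‖ := by
        rw [norm_smul, Complex.norm_of_nonneg hs.le]
    _ ≤ (Λ + s * (K * ∑ l, |β l|)) * ‖v‖ + (Λ + 0 * (K * ∑ l, |β l|)) * ‖v‖ := by
        rw [hsub]
        exact (norm_sub_le _ _).trans (add_le_add (hL s hs.le) (hL 0 le_rfl))
    _ = 2 * Λ * ‖v‖ + s * (K * (∑ l, |β l|) * ‖v‖) := by ring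

theorem abs_lamJ_sub_le (hS : MeasurableEigendecomposition Q K lam psi) (κ : Rd d) (ω : ℝ) (j : ℕ)
    (ℓ : Fin n) (θ : Rd d) :
    |lamJ κ ω lam j ℓ θ - lamJ κ ω lam j ℓ 0| ≤ K * ∑ l, |θ l| := by
  simpa [lamJ] using hS.lipschitz ℓ ((j : ℝ) • κ) ((j : ℝ) • κ + θ)

theorem hamiltonian_eq_spectralMap (hS : MeasurableEigendecomposition Q K lam psi) (κ : Rd d)
    (ω ε : ℝ) (j : ℕ) (k : Rd d) (v : Cn n) : Q.hamiltonian κ ω ε j k v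
      = spectralMap ℂ (fun ℓ => psi ℓ ((j : ℝ) • κ + ε • k))
        (fun ℓ => (ε : ℂ)⁻¹ * (lamJ κ ω lam j ℓ (ε • k) : ℂ)) v := by
  rw [HypSystem.hamiltonian, LinearMap.smul_apply, hS.toEuclideanLin_L_eq_spectralMap,
    ← smul_apply, ← map_smul]
  rfl

/-- The Fourier multiplier on `W` which multiplies the component of `û(k)` along
`ψ_ℓ(jκ + εk)` by the constant `c_ℓ`. -/
noncomputable def mul (hS : MeasurableEigendecomposition Q K lam psi) (κ : Rd d) (ε : ℝ) (j : ℕ)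
    (c : Fin n → ℂ) : Wiener d n →L[ℂ] Wiener d n :=
  mulL1 (s := fun k => spectralMap ℂ (fun ℓ => psi ℓ ((j : ℝ) • κ + ε • k)) c) <|
    memLp_top_of_bound
      (stronglyMeasurable_spectralMap (fun ℓ => ((hS.measurable_psi ℓ).comp
        (by fun_prop : Measurable fun k : Rd d => (j : ℝ) • κ + ε • k)).stronglyMeasurable)
        c).aestronglyMeasurable ‖c‖ <| ae_of_all _ fun _ =>
      ContinuousLinearMap.opNorm_le_bound _ (norm_nonneg c) fun x =>
        norm_spectralMap_le (hS.orthonormal _) (norm_nonneg c) (norm_le_pi_norm c) x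

variable {κ : Rd d} {ω ε : ℝ} {j : ℕ}

theorem coeFn_mul (hS : MeasurableEigendecomposition Q K lam psi) (κ : Rd d) (ε : ℝ) (j : ℕ)
    (c : Fin n → ℂ) (f : Wiener d n) : hS.mul κ ε j c f =ᵐ[volume]
      fun k => spectralMap ℂ (fun ℓ => psi ℓ ((j : ℝ) • κ + ε • k)) c (f k) :=
  coeFn_mulL1 _ f

theorem mul_one_apply (hS : MeasurableEigendecomposition Q K lam psi) (f : Wiener d n) :
    hS.mul κ ε j 1 f = f := by
  refine Lp.ext ?_
  filter_upwards [hS.coeFn_mul κ ε j 1 f] with k hk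
  rw [hk, spectralMap_one (hS.orthonormal _) (by simp)]

theorem mul_sub_apply (hS : MeasurableEigendecomposition Q K lam psi) (c c' : Fin n → ℂ)
    (f : Wiener d n) : hS.mul κ ε j (c - c') f = hS.mul κ ε j c f - hS.mul κ ε j c' f := by
  refine Lp.ext ?_
  filter_upwards [hS.coeFn_mul κ ε j (c - c') f, hS.coeFn_mul κ ε j c f, hS.coeFn_mul κ ε j c' f,
    Lp.coeFn_sub (hS.mul κ ε j c f) (hS.mul κ ε j c' f)] with k h1 h2 h3 h4
  rw [h1, h4, Pi.sub_apply, h2, h3, map_sub, sub_apply]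

theorem norm_mul_le (hS : MeasurableEigendecomposition Q K lam psi) {c : Fin n → ℂ} {C : ℝ}
    (hC : 0 ≤ C) (hc : ∀ ℓ, ‖c ℓ‖ ≤ C) (f : Wiener d n) : ‖hS.mul κ ε j c f‖ ≤ C * ‖f‖ := by
  refine Lp.norm_le_mul_norm_of_ae_le_mul ?_
  filter_upwards [hS.coeFn_mul κ ε j c f] with k hk
  rw [hk]
  exact norm_spectralMap_le (hS.orthonormal _) hC hc _

theorem isTransport_mul (hS : MeasurableEigendecomposition Q K lam psi) {τ : ℝ}
    {a a' f : ℝ → Wiener d n} (ha : IsTransport (Q.hamiltonian κ ω ε j) τ a a' f)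
    (c : Fin n → ℂ) :
    IsTransport (Q.hamiltonian κ ω ε j) τ (fun t => hS.mul κ ε j c (a t))
      (fun t => hS.mul κ ε j c (a' t)) (fun t => hS.mul κ ε j c (f t)) :=
  ha.map_mulL1 _ fun k v => by
    simp only [hS.hamiltonian_eq_spectralMap, spectralMap_spectralMap (hS.orthonormal _), mul_comm]

-- Up to a first order error, uniformly in `ε`, the Hamiltonian acts by its values at `k = 0`.
theorem exists_hamiltonian_mul (hS : MeasurableEigendecomposition Q K lam psi) (hε : 0 < ε)
    {c : Fin n → ℂ} {C : ℝ} (hC : 0 ≤ C) (hK : 0 ≤ K) (hc : ∀ ℓ, ‖c ℓ‖ ≤ C) {f : Wiener d n}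
    {f' : Fin d → Wiener d n} (hf : ∀ l, Wiener.HasFourierPartial l f (f' l)) :
    ∃ g : Wiener d n, (∀ᵐ k, g k = Q.hamiltonian κ ω ε j k (hS.mul κ ε j c f k)
      - (ε : ℂ)⁻¹ • hS.mul κ ε j (lamZero κ ω lam j * c) f k)
      ∧ ‖g‖ ≤ C * K * ∑ l, ‖f' l‖ := by
  have hH := HypSystem.aestronglyMeasurable_hamiltonian (Q := Q) hε.ne' (κ := κ) (ω := ω) (j := j)
    (Lp.aestronglyMeasurable (hS.mul κ ε j c f))
  have hH₀ :=
    (Lp.aestronglyMeasurable (hS.mul κ ε j (lamZero κ ω lam j * c) f)).const_smul (ε : ℂ)⁻¹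
  refine Wiener.exists_ae_eq_norm_le_of_hasFourierPartial hf (hH.sub hH₀) ?_
  filter_upwards [hS.coeFn_mul κ ε j c f, hS.coeFn_mul κ ε j (lamZero κ ω lam j * c) f] with k h1 h2
  rw [Pi.sub_apply, Pi.smul_apply, h1, h2, hS.hamiltonian_eq_spectralMap,
    spectralMap_spectralMap (hS.orthonormal _), ← smul_apply, ← map_smul, ← sub_apply, ← map_sub]
  refine norm_spectralMap_le (hS.orthonormal _) (by positivity) (fun ℓ => ?_) _
  have hfreq : (ε : ℂ)⁻¹ * (lamJ κ ω lam j ℓ (ε • k) : ℂ) * c ℓ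
      - (ε : ℂ)⁻¹ * ((lamJ κ ω lam j ℓ 0 : ℂ) * c ℓ)
      = ((ε⁻¹ * (lamJ κ ω lam j ℓ (ε • k) - lamJ κ ω lam j ℓ 0) : ℝ) : ℂ) * c ℓ := by
    push_cast
    ring
  have hlip : |ε⁻¹ * (lamJ κ ω lam j ℓ (ε • k) - lamJ κ ω lam j ℓ 0)| ≤ K * ∑ l, |k l| := by
    have h := hS.abs_lamJ_sub_le κ ω j ℓ (ε • k)
    simp only [PiLp.smul_apply, smul_eq_mul, abs_mul, abs_of_pos hε, ← Finset.mul_sum] at h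
    rw [abs_mul, abs_inv, abs_of_pos hε, inv_mul_le_iff₀ hε]
    linarith
  simp only [Pi.sub_apply, Pi.mul_apply, Pi.smul_apply, smul_eq_mul, lamZero, hfreq]
  rw [norm_mul, norm_real, Real.norm_eq_abs, mul_comm, mul_assoc]
  exact mul_le_mul (hc ℓ) hlip (abs_nonneg _) hC

end Spectral

end MeasurableEigendecomposition

/-! ### The normal form transformation -/

theorem norm_lamZero_inv_le {d n : ℕ} {κ : Rd d} {ω : ℝ} {lam : Fin n → Rd d → ℝ} {j : ℕ} {G : ℝ}
    {ℓ : Fin n} (h : lamJ κ ω lam j ℓ 0 ≠ 0 → |lamJ κ ω lam j ℓ 0|⁻¹ ≤ G) :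
    ‖(lamZero κ ω lam j)⁻¹ ℓ‖ ≤ |G| := by
  rw [Pi.inv_apply, lamZero, norm_inv, norm_real, Real.norm_eq_abs]
  rcases eq_or_ne (lamJ κ ω lam j ℓ 0) 0 with h0 | h0
  · rw [h0, abs_zero, inv_zero]
    exact abs_nonneg G
  · exact (h h0).trans (le_abs_self G)

theorem norm_lamZero_mul_inv_le_one {d n : ℕ} (κ : Rd d) (ω : ℝ) (lam : Fin n → Rd d → ℝ) (j : ℕ)
    (ℓ : Fin n) : ‖(lamZero κ ω lam j * (lamZero κ ω lam j)⁻¹) ℓ‖ ≤ 1 := by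
  rw [Pi.mul_apply, Pi.inv_apply, norm_mul, norm_inv]
  exact mul_inv_le_one

namespace MeasurableEigendecomposition

section NormalForm

variable {d n : ℕ} {Q : HypSystem d n} {K G : ℝ} {lam : Fin n → Rd d → ℝ}
  {psi : Fin n → Rd d → Cn n} {κ : Rd d} {ω ε : ℝ} {j : ℕ}

theorem norm_nonresonant_le_of_ae_mem_ker (hS : MeasurableEigendecomposition Q K lam psi)
    (hε : 0 < ε) (hK : 0 ≤ K) (hG0 : 0 ≤ G) (hG : ∀ ℓ, ‖(lamZero κ ω lam j)⁻¹ ℓ‖ ≤ G)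
    {p : Wiener d n} (hp : Wiener.MemW1 p)
    (hker : ∀ᵐ k : Rd d, Matrix.toEuclideanLin (Q.L (j * ω) ((j : ℝ) • κ)) (p k) = 0) :
    ‖hS.mul κ ε j (lamZero κ ω lam j * (lamZero κ ω lam j)⁻¹) p‖
      ≤ ε * (2 * G * K * Wiener.normW1 p) := by
  set c := (lamZero κ ω lam j)⁻¹
  have hpartial := fun l => hp.hasFourierPartial l
  obtain ⟨g, hg, hgle⟩ := hS.exists_hamiltonian_mul (κ := κ) (ω := ω) hε hG0 hK hG hpartial
  obtain ⟨h, hh, hhle⟩ : ∃ h : Wiener d n,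
      h =ᵐ[volume] (fun k => Q.hamiltonian κ ω ε j k (hS.mul κ ε j c p k)) ∧
        ‖h‖ ≤ G * K * ∑ l, ‖Wiener.partialD l p‖ := by
    refine Wiener.exists_ae_eq_norm_le_of_hasFourierPartial hpartial
      (HypSystem.aestronglyMeasurable_hamiltonian hε.ne' (Lp.aestronglyMeasurable _)) ?_
    filter_upwards [hS.coeFn_mul κ ε j c p, hker] with k h1 h2
    have hcomm : Q.hamiltonian κ ω ε j k (hS.mul κ ε j c p k)
        = spectralMap ℂ (fun ℓ => psi ℓ ((j : ℝ) • κ + ε • k)) c (Q.symbolA k (p k)) := by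
      rw [h1, hS.hamiltonian_eq_spectralMap, spectralMap_spectralMap (hS.orthonormal _), mul_comm,
        ← spectralMap_spectralMap (hS.orthonormal _), ← hS.hamiltonian_eq_spectralMap,
        Q.hamiltonian_eq_add hε.ne', h2, smul_zero, zero_add]
    rw [hcomm, mul_assoc G, mul_assoc G]
    exact (norm_spectralMap_le (hS.orthonormal _) hG0 hG _).trans
      (mul_le_mul_of_nonneg_left (hS.norm_symbolA_le hK k _) hG0)
  have heq : hS.mul κ ε j (lamZero κ ω lam j * c) p = (ε : ℂ) • (h - g) := by
    refine Lp.ext ?_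
    filter_upwards [hg, hh, Lp.coeFn_smul (ε : ℂ) (h - g), Lp.coeFn_sub h g] with k h1 h2 h3 h4
    rw [h3, Pi.smul_apply, h4, Pi.sub_apply, h1, h2, sub_sub_cancel, smul_smul,
      mul_inv_cancel₀ (ofReal_ne_zero.2 hε.ne'), one_smul]
  have hsum : ∑ l, ‖Wiener.partialD l p‖ ≤ Wiener.normW1 p :=
    le_add_of_nonneg_left (norm_nonneg p)
  rw [heq, norm_smul, Complex.norm_of_nonneg hε.le]
  gcongr
  calc ‖h - g‖ ≤ ‖h‖ + ‖g‖ := norm_sub_le h g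
    _ ≤ G * K * (∑ l, ‖Wiener.partialD l p‖) + G * K * ∑ l, ‖Wiener.partialD l p‖ :=
        add_le_add hhle hgle
    _ = 2 * G * K * ∑ l, ‖Wiener.partialD l p‖ := by ring
    _ ≤ 2 * G * K * Wiener.normW1 p := by gcongr

variable {τ m m' m₁ δ : ℝ} {N N' w w' f : ℝ → Wiener d n} {dN : ℝ → Fin d → Wiener d n}

theorem exists_isTransport_resolvent (hS : MeasurableEigendecomposition Q K lam psi)
    (hε : 0 < ε) (hK : 0 ≤ K) (hG0 : 0 ≤ G) (hG : ∀ ℓ, ‖(lamZero κ ω lam j)⁻¹ ℓ‖ ≤ G)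
    (hcont : ContinuousOn N (Icc 0 τ))
    (hderiv : ∀ t ∈ Ioc 0 τ, HasDerivWithinAt N (N' t) (Icc 0 τ) t)
    (hpartial : ∀ t ∈ Ioc 0 τ, ∀ l, Wiener.HasFourierPartial l (N t) (dN t l)) :
    ∃ q : ℝ → Wiener d n, (∀ t ∈ Ioc 0 τ, ‖q t‖ ≤ G * K * ∑ l, ‖dN t l‖) ∧
      IsTransport (Q.hamiltonian κ ω ε j) τ
        (fun t => (I * ε ^ 2) • hS.mul κ ε j (lamZero κ ω lam j)⁻¹ (N t))
        (fun t => (I * ε ^ 2) • hS.mul κ ε j (lamZero κ ω lam j)⁻¹ (N' t))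
        (fun t => (I * ε ^ 2) • hS.mul κ ε j (lamZero κ ω lam j)⁻¹ (N' t)
          - (ε : ℂ) • hS.mul κ ε j (lamZero κ ω lam j * (lamZero κ ω lam j)⁻¹) (N t)
          - ((ε : ℂ) ^ 2) • q t) := by
  set c := (lamZero κ ω lam j)⁻¹
  have hex := fun t ht =>
    hS.exists_hamiltonian_mul (κ := κ) (ω := ω) (j := j) hε hG0 hK hG (hpartial t ht)
  choose! q hq hqle using hex
  have hRcont : ContinuousOn (fun t => hS.mul κ ε j c (N t)) (Icc 0 τ) :=
    (hS.mul κ ε j c).continuous.comp_continuousOn hcont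
  refine ⟨q, hqle, hRcont.const_smul (I * (ε : ℂ) ^ 2),
    fun t ht => (((hS.mul κ ε j c).restrictScalars ℝ).hasFDerivAt.comp_hasDerivWithinAt t
      (hderiv t ht)).const_smul (I * (ε : ℂ) ^ 2), fun t ht => ?_⟩
  set r := hS.mul κ ε j c (N t)
  set r' := hS.mul κ ε j c (N' t)
  set s := hS.mul κ ε j (lamZero κ ω lam j * c) (N t)
  filter_upwards [hq t ht, Lp.coeFn_smul (I * (ε : ℂ) ^ 2) r, Lp.coeFn_smul (ε : ℂ) s,
    Lp.coeFn_smul ((ε : ℂ) ^ 2) (q t), Lp.coeFn_sub ((I * (ε : ℂ) ^ 2) • r') ((ε : ℂ) • s),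
    Lp.coeFn_sub ((I * (ε : ℂ) ^ 2) • r' - (ε : ℂ) • s) (((ε : ℂ) ^ 2) • q t)]
    with k h1 h2 h3 h4 h5 h6
  have hε' : (ε : ℂ) ^ 2 * (ε : ℂ)⁻¹ = ε := by field_simp
  rw [h6, Pi.sub_apply, h5, Pi.sub_apply, h2, h3, h4, Pi.smul_apply, Pi.smul_apply, Pi.smul_apply,
    h1, map_smul, smul_smul, ← mul_assoc, I_mul_I, smul_sub, smul_smul, hε', neg_one_mul, neg_smul]
  abel

theorem norm_smul_mul_le (hS : MeasurableEigendecomposition Q K lam psi) (hG0 : 0 ≤ G)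
    (hG : ∀ ℓ, ‖(lamZero κ ω lam j)⁻¹ ℓ‖ ≤ G) (g : Wiener d n) :
    ‖(I * (ε : ℂ) ^ 2) • hS.mul κ ε j (lamZero κ ω lam j)⁻¹ g‖ ≤ ε ^ 2 * (G * ‖g‖) := by
  have hnorm : ‖I * (ε : ℂ) ^ 2‖ = ε ^ 2 := by simp
  rw [norm_smul, hnorm]
  gcongr
  exact hS.norm_mul_le hG0 hG g

theorem norm_normalForm_forcing_le (hS : MeasurableEigendecomposition Q K lam psi) (hε : 0 < ε)
    (hG0 : 0 ≤ G) (hG : ∀ ℓ, ‖(lamZero κ ω lam j)⁻¹ ℓ‖ ≤ G) (f g g' q : Wiener d n) :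
    ‖hS.mul κ ε j (lamZero κ ω lam j * (lamZero κ ω lam j)⁻¹) ((ε : ℂ) • f)
        + ((I * (ε : ℂ) ^ 2) • hS.mul κ ε j (lamZero κ ω lam j)⁻¹ g'
        - (ε : ℂ) • hS.mul κ ε j (lamZero κ ω lam j * (lamZero κ ω lam j)⁻¹) g
        - (ε : ℂ) ^ 2 • q)‖
      ≤ ε * ‖f - g‖ + ε ^ 2 * (G * ‖g'‖) + ε ^ 2 * ‖q‖ := by
  set P := hS.mul κ ε j (lamZero κ ω lam j * (lamZero κ ω lam j)⁻¹)
  set r := (I * (ε : ℂ) ^ 2) • hS.mul κ ε j (lamZero κ ω lam j)⁻¹ g'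
  have hP : ‖P (f - g)‖ ≤ ‖f - g‖ :=
    (hS.norm_mul_le zero_le_one (norm_lamZero_mul_inv_le_one κ ω lam j) _).trans_eq (one_mul _)
  have hsplit : P ((ε : ℂ) • f) + (r - (ε : ℂ) • P g - (ε : ℂ) ^ 2 • q)
      = (ε : ℂ) • P (f - g) + r - (ε : ℂ) ^ 2 • q := by
    rw [map_smul, map_sub, smul_sub]
    abel
  calc _ ≤ ‖(ε : ℂ) • P (f - g)‖ + ‖r‖ + ‖(ε : ℂ) ^ 2 • q‖ := by
        rw [hsplit]
        exact (norm_sub_le _ _).trans (add_le_add_left (norm_add_le _ _) _)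
    _ ≤ _ := by
        rw [norm_smul (ε : ℂ), norm_smul ((ε : ℂ) ^ 2), norm_pow, Complex.norm_of_nonneg hε.le]
        gcongr
        exact hS.norm_smul_mul_le hG0 hG _

-- Let `P` be the nonresonant projection and `R` the division of the nonresonant components by
-- `λ_{jℓ}(0)`. The forcing of `P w + iε² R N` contains `f` at order `ε` only through `f - N`.
theorem norm_nonresonant_le (hS : MeasurableEigendecomposition Q K lam psi) (hε : 0 < ε)
    (hK : 0 ≤ K) (hG0 : 0 ≤ G) (hG : ∀ ℓ, ‖(lamZero κ ω lam j)⁻¹ ℓ‖ ≤ G)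
    (hw : IsTransport (Q.hamiltonian κ ω ε j) τ w w' fun t => (ε : ℂ) • f t)
    (hcont : ContinuousOn N (Icc 0 τ))
    (hderiv : ∀ t ∈ Ioc 0 τ, HasDerivWithinAt N (N' t) (Icc 0 τ) t)
    (hpartial : ∀ t ∈ Ioc 0 τ, ∀ l, Wiener.HasFourierPartial l (N t) (dN t l))
    (hN : ∀ t ∈ Icc 0 τ, ‖N t‖ ≤ m) (hN' : ∀ t ∈ Ioc 0 τ, ‖N' t‖ ≤ m')
    (hdN : ∀ t ∈ Ioc 0 τ, ∑ l, ‖dN t l‖ ≤ m₁) (hf : ∀ t ∈ Ioc 0 τ, ‖f t - N t‖ ≤ δ) :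
    ∀ t ∈ Icc 0 τ, ‖hS.mul κ ε j (lamZero κ ω lam j * (lamZero κ ω lam j)⁻¹) (w t)‖
      ≤ ‖hS.mul κ ε j (lamZero κ ω lam j * (lamZero κ ω lam j)⁻¹) (w 0)‖
        + 2 * (ε ^ 2 * (G * m)) + (ε * δ + ε ^ 2 * (G * m') + ε ^ 2 * (G * K * m₁)) * t := by
  obtain ⟨q, hq, hb⟩ := hS.exists_isTransport_resolvent (κ := κ) (ω := ω) hε hK hG0 hG hcont
    hderiv hpartial
  set P := hS.mul κ ε j (lamZero κ ω lam j * (lamZero κ ω lam j)⁻¹)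
  set b : ℝ → Wiener d n := fun t => (I * (ε : ℂ) ^ 2) • hS.mul κ ε j (lamZero κ ω lam j)⁻¹ (N t)
  have hbm : ∀ t ∈ Icc 0 τ, ‖b t‖ ≤ ε ^ 2 * (G * m) := fun t ht =>
    (hS.norm_smul_mul_le hG0 hG (N t)).trans (by gcongr; exact hN t ht)
  intro t ht
  have hforcing : ∀ s ∈ Ioc 0 τ, ‖P ((ε : ℂ) • f s)
      + ((I * (ε : ℂ) ^ 2) • hS.mul κ ε j (lamZero κ ω lam j)⁻¹ (N' s) - (ε : ℂ) • P (N s)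
        - (ε : ℂ) ^ 2 • q s)‖ ≤ ε * δ + ε ^ 2 * (G * m') + ε ^ 2 * (G * K * m₁) := fun s hs => by
    refine (hS.norm_normalForm_forcing_le hε hG0 hG (f s) (N s) (N' s) (q s)).trans ?_
    gcongr
    · exact hf s hs
    · exact hN' s hs
    · exact (hq s hs).trans (by gcongr; exact hdN s hs)
  have hsum := ((hS.isTransport_mul hw _).add hb).norm_le (Q.hamiltonian_isSymmetric κ ω ε j)
    hforcing t ht
  calc ‖P (w t)‖ = ‖(P (w t) + b t) - b t‖ := by rw [add_sub_cancel_right]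
    _ ≤ ‖P (w t) + b t‖ + ‖b t‖ := norm_sub_le _ _
    _ ≤ (‖P (w 0)‖ + ‖b 0‖ + (ε * δ + ε ^ 2 * (G * m') + ε ^ 2 * (G * K * m₁)) * t) + ‖b t‖ := by
        gcongr
        exact hsum.trans (by gcongr; exact norm_add_le _ _)
    _ ≤ _ := by linarith [hbm t ht, hbm 0 ⟨le_rfl, ht.1.trans ht.2⟩]

end NormalForm

end MeasurableEigendecomposition

/-! ### Smallness of the nonresonant modes -/

theorem eq_of_mem_of_finrank_eq_one {𝕜 E ι : Type*} [RCLike 𝕜] [NormedAddCommGroup E]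
    [InnerProductSpace 𝕜 E] {v : ι → E} (hv : Orthonormal 𝕜 v) {S : Submodule 𝕜 E}
    (hS : Module.finrank 𝕜 S = 1) {i j : ι} (hi : v i ∈ S) (hj : v j ∈ S) : i = j := by
  by_contra hij
  obtain ⟨c, hc⟩ := exists_smul_eq_of_finrank_eq_one hS
    (x := ⟨v i, hi⟩) (fun h => hv.ne_zero i (congrArg Subtype.val h)) ⟨v j, hj⟩
  have hvj : c • v i = v j := congrArg Subtype.val hc
  have hc0 : c = 0 := by
    have horth : inner 𝕜 (v i) (v j) = 0 := hv.2 hij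
    rwa [← hvj, inner_smul_right, inner_self_eq_norm_sq_to_K, hv.1 i, RCLike.ofReal_one, one_pow,
      mul_one] at horth
  exact hv.ne_zero j (by rw [← hvj, hc0, zero_smul])

theorem norm_single_one_apply_le {ι : Type*} [DecidableEq ι] (i j : ι) :
    ‖(Pi.single i 1 : ι → ℂ) j‖ ≤ 1 := by
  rcases eq_or_ne j i with rfl | h <;> simp [*]

theorem Wiener.ae_mem_ker {d n : ℕ} {p : Wiener d n} {T : Cn n →ₗ[ℂ] Cn n}
    (h : ∀ x, Wiener.eval p x ∈ LinearMap.ker T) : ∀ᵐ k : Rd d, T (p k) = 0 := by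
  have hzero : (LinearMap.toContinuousLinearMap T).compLp p = 0 := 
    Wiener.eq_of_eval_eq fun x => by
      rw [Wiener.eval_compLp, ← Wiener.evalₗ_apply x 0, map_zero]
      exact h x
  filter_upwards [Lp.eq_zero_iff_ae_eq_zero.1 hzero,
    (LinearMap.toContinuousLinearMap T).coeFn_compLp p] with k h1 h2
  exact h2.symm.trans h1

namespace MeasurableEigendecomposition

section Modes

variable {d n : ℕ} {Q : HypSystem d n} {K : ℝ} {lam : Fin n → Rd d → ℝ}
  {psi : Fin n → Rd d → Cn n} {κ : Rd d} {ω ε : ℝ} {j : ℕ} {ℓ₁ : Fin n}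

theorem toEuclideanLin_L_psi_of_lamJ_eq_zero (hS : MeasurableEigendecomposition Q K lam psi)
    {ℓ : Fin n} (hℓ : lamJ κ ω lam j ℓ 0 = 0) :
    Matrix.toEuclideanLin (Q.L (j * ω) ((j : ℝ) • κ)) (psi ℓ ((j : ℝ) • κ)) = 0 := by
  have h : lam ℓ ((j : ℝ) • κ) - j * ω = 0 := by simpa [lamJ] using hℓ
  rw [hS.toEuclideanLin_L_psi, h, ofReal_zero, zero_smul]

theorem lamZero_one_mul_inv (hS : MeasurableEigendecomposition Q K lam psi)
    (hker : Module.finrank ℂ (LinearMap.ker (Matrix.toEuclideanLin (Q.L ω κ))) = 1)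
    (hℓ₁ : lamJ κ ω lam 1 ℓ₁ 0 = 0) :
    lamZero κ ω lam 1 * (lamZero κ ω lam 1)⁻¹ = 1 - Pi.single ℓ₁ 1 := by
  have hmem : ∀ ℓ, lamJ κ ω lam 1 ℓ 0 = 0 →
      psi ℓ κ ∈ LinearMap.ker (Matrix.toEuclideanLin (Q.L ω κ)) := fun ℓ hℓ => by
    simpa using hS.toEuclideanLin_L_psi_of_lamJ_eq_zero hℓ
  funext ℓ
  rcases eq_or_ne ℓ ℓ₁ with rfl | hne
  · simp [lamZero, hℓ₁]
  · have hℓ : lamJ κ ω lam 1 ℓ 0 ≠ 0 := fun h =>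
      hne (eq_of_mem_of_finrank_eq_one (hS.orthonormal κ) hker (hmem ℓ h) (hmem ℓ₁ hℓ₁))
    simp [lamZero, hℓ, hne]

theorem lamZero_mul_inv_eq_one (hS : MeasurableEigendecomposition Q K lam psi)
    (hL : IsUnit (Q.L (j * ω) ((j : ℝ) • κ))) :
    lamZero κ ω lam j * (lamZero κ ω lam j)⁻¹ = 1 := by
  funext ℓ
  have hℓ : lamJ κ ω lam j ℓ 0 ≠ 0 := fun h => by
    have hpsi := congrArg WithLp.ofLp (hS.toEuclideanLin_L_psi_of_lamJ_eq_zero h)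
    have hzero := Matrix.mulVec_injective_of_isUnit hL (hpsi.trans (Matrix.mulVec_zero _).symm)
    exact (hS.orthonormal _).ne_zero ℓ (WithLp.ofLp_injective 2 hzero)
  simp [lamZero, hℓ]

/-- The Fourier multiplier `u ↦ 𝒫_ε û`, which keeps the component along the carrier wave. -/
noncomputable def carrierProj (hS : MeasurableEigendecomposition Q K lam psi) (κ : Rd d) (ε : ℝ)
    (ℓ₁ : Fin n) : Wiener d n →L[ℂ] Wiener d n := hS.mul κ ε 1 (Pi.single ℓ₁ 1)

theorem coeFn_carrierProj (hS : MeasurableEigendecomposition Q K lam psi) (κ : Rd d) (ε : ℝ)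
    (ℓ₁ : Fin n) (f : Wiener d n) :
    hS.carrierProj κ ε ℓ₁ f =ᵐ[volume] eigProj κ psi ℓ₁ ε f := by
  filter_upwards [hS.coeFn_mul κ ε 1 (Pi.single ℓ₁ 1) f] with k hk
  rw [carrierProj, hk, spectralMap_single, eigProj, Nat.cast_one, one_smul]

theorem norm_carrierProj_le (hS : MeasurableEigendecomposition Q K lam psi) (κ : Rd d) (ε : ℝ)
    (ℓ₁ : Fin n) (f : Wiener d n) : ‖hS.carrierProj κ ε ℓ₁ f‖ ≤ ‖f‖ :=
  (hS.norm_mul_le zero_le_one (norm_single_one_apply_le ℓ₁) f).trans_eq (one_mul _)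

theorem hasFourierPartial_carrierProj (hS : MeasurableEigendecomposition Q K lam psi) (κ : Rd d)
    (ε : ℝ) (ℓ₁ : Fin n) {l : Fin d} {f f' : Wiener d n} (h : Wiener.HasFourierPartial l f f') :
    Wiener.HasFourierPartial l (hS.carrierProj κ ε ℓ₁ f) (hS.carrierProj κ ε ℓ₁ f') :=
  h.map_mulL1 _

theorem nonresonant_one_eq (hS : MeasurableEigendecomposition Q K lam psi)
    (hker : Module.finrank ℂ (LinearMap.ker (Matrix.toEuclideanLin (Q.L ω κ))) = 1)
    (hℓ₁ : lamJ κ ω lam 1 ℓ₁ 0 = 0) (f : Wiener d n) :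
    hS.mul κ ε 1 (lamZero κ ω lam 1 * (lamZero κ ω lam 1)⁻¹) f = f - hS.carrierProj κ ε ℓ₁ f := by
  rw [hS.lamZero_one_mul_inv hker hℓ₁, hS.mul_sub_apply, hS.mul_one_apply, carrierProj]

theorem norm_mul_le_of_ae_eq (hS : MeasurableEigendecomposition Q K lam psi) (hε : 0 < ε)
    (hK : 0 ≤ K) {c : Fin n → ℂ} (hc : ∀ ℓ, ‖c ℓ‖ ≤ 1) (hres : lamZero κ ω lam j * c = 0)
    {f a g : Wiener d n} {f' : Fin d → Wiener d n}
    (hf : ∀ l, Wiener.HasFourierPartial l f (f' l))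
    (ha : ∀ᵐ k, a k = -(I • Q.hamiltonian κ ω ε j k (f k)) + g k) :
    ‖hS.mul κ ε j c a‖ ≤ K * (∑ l, ‖f' l‖) + ‖g‖ := by
  obtain ⟨q, hq, hqle⟩ := hS.exists_hamiltonian_mul (κ := κ) (ω := ω) (j := j) hε zero_le_one hK
    hc hf
  have heq : hS.mul κ ε j c a = -(I • q) + hS.mul κ ε j c g := by
    refine Lp.ext ?_
    filter_upwards [hq, ha, hS.coeFn_mul κ ε j c a, hS.coeFn_mul κ ε j c f,
      hS.coeFn_mul κ ε j c g, hS.coeFn_mul κ ε j (lamZero κ ω lam j * c) f, Lp.coeFn_smul I q,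
      Lp.coeFn_neg (I • q), Lp.coeFn_add (-(I • q)) (hS.mul κ ε j c g)]
      with k h1 h2 h3 h4 h5 h6 h7 h8 h9
    rw [h9, Pi.add_apply, h8, Pi.neg_apply, h7, Pi.smul_apply, h1, h3, h4, h5, h6, h2, hres,
      map_zero, zero_apply, smul_zero, sub_zero, map_add, map_neg, map_smul]
    simp only [hS.hamiltonian_eq_spectralMap, spectralMap_spectralMap (hS.orthonormal _), mul_comm]
  calc ‖hS.mul κ ε j c a‖ ≤ ‖-(I • q)‖ + ‖hS.mul κ ε j c g‖ := heq ▸ norm_add_le _ _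
    _ ≤ 1 * K * (∑ l, ‖f' l‖) + 1 * ‖g‖ := by
        rw [norm_neg, norm_smul, norm_I, one_mul]
        exact add_le_add hqle (hS.norm_mul_le zero_le_one hc g)
    _ = _ := by rw [one_mul, one_mul]

theorem norm_nonresonant_cubic_le (hS : MeasurableEigendecomposition Q K lam psi) (hε : 0 < ε)
    (hK : 0 ≤ K) {G C B b₁ b' η T : ℝ} (hG0 : 0 ≤ G) (hG : ∀ ℓ, ‖(lamZero κ ω lam j)⁻¹ ℓ‖ ≤ G)
    (hC : ‖Q.nonlinForm (d := d) j‖ ≤ C) {w w' : ℝ → Wiener d n}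
    {U V V' : ℝ → Wiener d n × Wiener d n} {dV : ℝ → Fin d → Wiener d n × Wiener d n}
    (hw : IsTransport (Q.hamiltonian κ ω ε j) T w w' fun t =>
      (ε : ℂ) • Q.nonlinForm j fun _ => U t)
    (hcont : ContinuousOn V (Icc 0 T))
    (hderiv : ∀ t ∈ Ioc 0 T, HasDerivWithinAt V (V' t) (Icc 0 T) t)
    (hpartial : ∀ t ∈ Ioc 0 T, ∀ l, Wiener.HasFourierPartial l (Q.nonlinForm j fun _ => V t)
      ((Q.nonlinForm j).linearDeriv (fun _ => V t) fun _ => dV t l))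
    (hU : ∀ t ∈ Icc 0 T, ‖U t‖ ≤ B) (hV : ∀ t ∈ Icc 0 T, ‖V t‖ ≤ B)
    (hV' : ∀ t ∈ Ioc 0 T, ‖V' t‖ ≤ b') (hdV : ∀ t ∈ Ioc 0 T, ∑ l, ‖dV t l‖ ≤ b₁)
    (hUV : ∀ t ∈ Ioc 0 T, ‖U t - V t‖ ≤ η) :
    ∀ t ∈ Icc 0 T, ‖hS.mul κ ε j (lamZero κ ω lam j * (lamZero κ ω lam j)⁻¹) (w t)‖
      ≤ ‖hS.mul κ ε j (lamZero κ ω lam j * (lamZero κ ω lam j)⁻¹) (w 0)‖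
        + 2 * (ε ^ 2 * (G * (C * B ^ 3))) + (ε * (3 * C * B ^ 2 * η)
          + ε ^ 2 * (G * (3 * C * B ^ 2 * b')) + ε ^ 2 * (G * K * (3 * C * B ^ 2 * b₁))) * t := by
  have hC0 : 0 ≤ C := (norm_nonneg _).trans hC
  refine hS.norm_nonresonant_le hε hK hG0 hG hw (N := fun t => Q.nonlinForm j fun _ => V t)
    ((Q.nonlinForm j).cont.comp_continuousOn (continuousOn_pi.2 fun _ => hcont))
    (fun t ht => hasDerivWithinAt_cubic (hderiv t ht)) hpartial
    (fun t ht => norm_cubic_le hC (hV t ht)) (fun t ht => ?_) (fun t ht => ?_) (fun t ht => ?_)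
  · exact (norm_cubic_linearDeriv_le hC (hV t ⟨ht.1.le, ht.2⟩)).trans (by gcongr; exact hV' t ht)
  · refine (Finset.sum_le_sum fun l _ =>
      norm_cubic_linearDeriv_le hC (hV t ⟨ht.1.le, ht.2⟩)).trans ?_
    rw [← Finset.mul_sum]
    gcongr
    exact hdV t ht
  · exact (norm_cubic_sub_le hC (hU t ⟨ht.1.le, ht.2⟩) (hV t ⟨ht.1.le, ht.2⟩)).trans
      (by gcongr; exact hUV t ht)

end Modes

end MeasurableEigendecomposition

theorem Wiener.sum_norm_partialD_le {d n : ℕ} {f g : Wiener d n} {B : ℝ}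
    (h : normW1 f + normW1 g ≤ B) : ∑ l, ‖partialD l f‖ ≤ B := by
  have := normW1_nonneg g
  have := norm_nonneg f
  rw [normW1] at h
  linarith

namespace IsClassicalSolution

section Remainder

variable {d n : ℕ} {Q : HypSystem d n} {K : ℝ} {lam : Fin n → Rd d → ℝ}
  {psi : Fin n → Rd d → Cn n} {κ : Rd d} {ω ε τ T B C G Y η σ : ℝ} {p : Wiener d n}
  {u₁ u₃ : ℝ → Wiener d n} {ℓ₁ : Fin n}

theorem norm_carrierProj_derivWithin_le (h : IsClassicalSolution Q κ ω ε τ p u₁ u₃)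
    (hS : MeasurableEigendecomposition Q K lam psi) (hε : ε ∈ Ioc 0 1) (hK : 0 ≤ K)
    (hC : ‖Q.nonlinForm (d := d) 1‖ ≤ C) (hℓ₁ : lamJ κ ω lam 1 ℓ₁ 0 = 0) {t : ℝ}
    (ht : t ∈ Ioc 0 τ) (hB : Wiener.normW1 (u₁ t) + Wiener.normW1 (u₃ t) ≤ B) :
    ‖hS.carrierProj κ ε ℓ₁ (derivWithin u₁ (Icc 0 τ) t)‖ ≤ K * B + C * B ^ 3 := by
  have hres : lamZero κ ω lam 1 * Pi.single ℓ₁ 1 = 0 := by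
    funext ℓ
    rcases eq_or_ne ℓ ℓ₁ with rfl | hne
    · simp [lamZero, hℓ₁]
    · simp [hne]
  have hN : ‖(ε : ℂ) • Q.nonlinForm 1 fun _ => (u₁ t, u₃ t)‖ ≤ C * B ^ 3 := by
    rw [norm_smul, Complex.norm_of_nonneg hε.1.le]
    exact (mul_le_of_le_one_left (norm_nonneg _) hε.2).trans
      (norm_cubic_le hC (Wiener.norm_prod_le hB))
  refine (hS.norm_mul_le_of_ae_eq hε.1 hK (norm_single_one_apply_le ℓ₁) hres
    (fun l => (h.regular₁.memW1 t ⟨ht.1.le, ht.2⟩).hasFourierPartial l)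
    ((h.isTransport₁ hε.1.ne').ae_eq t ht)).trans ?_
  gcongr
  exact Wiener.sum_norm_partialD_le hB

theorem norm_nonresonant_mode_le (h : IsClassicalSolution Q κ ω ε τ p u₁ u₃)
    (hS : MeasurableEigendecomposition Q K lam psi) (hε : ε ∈ Ioc 0 1) (hK : 0 ≤ K) (hG0 : 0 ≤ G)
    (hC : ∀ j, ‖Q.nonlinForm (d := d) j‖ ≤ C) (hℓ₁ : lamJ κ ω lam 1 ℓ₁ 0 = 0)
    (hT : T ∈ Icc 0 τ) (hB : ∀ t ∈ Icc 0 T, Wiener.normW1 (u₁ t) + Wiener.normW1 (u₃ t) ≤ B)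
    (hη : ∀ t ∈ Icc 0 T, ‖u₁ t - hS.carrierProj κ ε ℓ₁ (u₁ t)‖ + ‖u₃ t‖ ≤ η) {j : ℕ}
    (hG : ∀ ℓ, ‖(lamZero κ ω lam j)⁻¹ ℓ‖ ≤ G) {w w' : ℝ → Wiener d n}
    (hw : IsTransport (Q.hamiltonian κ ω ε j) τ w w' fun t =>
      (ε : ℂ) • Q.nonlinForm j fun _ => (u₁ t, u₃ t)) :
    ‖hS.mul κ ε j (lamZero κ ω lam j * (lamZero κ ω lam j)⁻¹) (w T)‖
      ≤ ‖hS.mul κ ε j (lamZero κ ω lam j * (lamZero κ ω lam j)⁻¹) (w 0)‖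
        + 2 * (ε ^ 2 * (G * (C * B ^ 3))) + (ε * (3 * C * B ^ 2 * η)
          + ε ^ 2 * (G * (3 * C * B ^ 2 * (K * B + C * B ^ 3)))
          + ε ^ 2 * (G * K * (3 * C * B ^ 2 * B))) * T := by
  -- The cubic term is compared with its value at `(𝒫_ε u₁, 0)`, whose time derivative is `O(1)`.
  let P := hS.carrierProj κ ε ℓ₁
  let R : Wiener d n →L[ℂ] Wiener d n × Wiener d n := (ContinuousLinearMap.inl ℂ _ _).comp P
  have hR : ∀ f, ‖R f‖ = ‖P f‖ := fun f =>
    (Prod.norm_mk (P f) 0).trans (by rw [norm_zero, max_eq_left (norm_nonneg _)])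
  have hRle : ∀ f, ‖R f‖ ≤ ‖f‖ := fun f => (hR f).trans_le (hS.norm_carrierProj_le κ ε ℓ₁ f)
  have hu := (h.isTransport₁ hε.1.ne').mono hT.2
  have hIoc : ∀ t ∈ Ioc 0 T, t ∈ Icc 0 T := fun t ht => ⟨ht.1.le, ht.2⟩
  have hpair := fun t ht => Wiener.norm_prod_le (hB t ht)
  have hpartial : ∀ t ∈ Ioc 0 T, ∀ l, Wiener.HasFourierPartial l
      (Q.nonlinForm j fun _ => R (u₁ t)) ((Q.nonlinForm j).linearDeriv (fun _ => R (u₁ t))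
        fun _ => R (Wiener.partialD l (u₁ t))) := fun t ht l =>
    Wiener.HasFourierPartial.nonlinForm (U := (P (u₁ t), 0))
      (U' := (P (Wiener.partialD l (u₁ t)), 0)) Q (hS.hasFourierPartial_carrierProj κ ε ℓ₁
        ((h.regular₁.memW1 t ⟨ht.1.le, ht.2.trans hT.2⟩).hasFourierPartial l)) .zero j
  refine hS.norm_nonresonant_cubic_le hε.1 hK hG0 hG (hC j) (hw.mono hT.2)
    (R.continuous.comp_continuousOn hu.continuousOn)
    (fun t ht => (R.restrictScalars ℝ).hasFDerivAt.comp_hasDerivWithinAt t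
      (hu.hasDerivWithinAt t ht)) hpartial hpair
    (fun t ht => (hRle _).trans ((norm_fst_le (u₁ t, u₃ t)).trans (hpair t ht)))
    (fun t ht => (hR _).trans_le (h.norm_carrierProj_derivWithin_le hS hε hK (hC 1) hℓ₁
      ⟨ht.1, ht.2.trans hT.2⟩ (hB t (hIoc t ht))))
    (fun t ht => (Finset.sum_le_sum fun l _ => hRle _).trans
      (Wiener.sum_norm_partialD_le (hB t (hIoc t ht)))) (fun t ht => ?_) T ⟨hT.1, le_rfl⟩
  refine le_trans ?_ (hη t (hIoc t ht))
  refine (Prod.norm_mk _ _).trans_le (max_le ?_ ?_)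
  · exact le_add_of_nonneg_right (norm_nonneg _)
  · exact (congrArg norm (sub_zero (u₃ t))).trans_le (le_add_of_nonneg_left (norm_nonneg _))

theorem norm_nonresonant_mode_le_mul (h : IsClassicalSolution Q κ ω ε τ p u₁ u₃)
    (hS : MeasurableEigendecomposition Q K lam psi) (hε : ε ∈ Ioc 0 1) (hK : 0 ≤ K) (hG0 : 0 ≤ G)
    (hC : ∀ j, ‖Q.nonlinForm (d := d) j‖ ≤ C) (hℓ₁ : lamJ κ ω lam 1 ℓ₁ 0 = 0)
    (hT : T ∈ Icc 0 τ) (hσ : ε * T ≤ σ) (hY0 : 0 ≤ Y)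
    (hB : ∀ t ∈ Icc 0 T, Wiener.normW1 (u₁ t) + Wiener.normW1 (u₃ t) ≤ B)
    (hY : ∀ t ∈ Icc 0 T, ‖u₁ t - hS.carrierProj κ ε ℓ₁ (u₁ t)‖ + ‖u₃ t‖ ≤ ε * Y) {j : ℕ}
    (hG : ∀ ℓ, ‖(lamZero κ ω lam j)⁻¹ ℓ‖ ≤ G) {w w' : ℝ → Wiener d n}
    (hw : IsTransport (Q.hamiltonian κ ω ε j) τ w w' fun t =>
      (ε : ℂ) • Q.nonlinForm j fun _ => (u₁ t, u₃ t)) :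
    ‖hS.mul κ ε j (lamZero κ ω lam j * (lamZero κ ω lam j)⁻¹) (w T)‖
      ≤ ‖hS.mul κ ε j (lamZero κ ω lam j * (lamZero κ ω lam j)⁻¹) (w 0)‖
        + ε * (2 * G * C * B ^ 3 + 3 * C * B ^ 2 * (Y + G * (2 * K * B + C * B ^ 3)) * σ) := by
  have hε0 := hε.1.le
  have hC0 : 0 ≤ C := (norm_nonneg _).trans (hC j)
  have : 0 ≤ B := (norm_nonneg _).trans (Wiener.norm_prod_le (hB 0 ⟨le_rfl, hT.1⟩))
  refine (h.norm_nonresonant_mode_le hS hε hK hG0 hC hℓ₁ hT hB hY hG hw).trans ?_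
  rw [add_assoc]
  refine add_le_add_right ?_ _
  calc _ = ε * (ε * (2 * G * C * B ^ 3)
        + 3 * C * B ^ 2 * (Y + G * (2 * K * B + C * B ^ 3)) * (ε * T)) := by ring
    _ ≤ _ := by
        refine mul_le_mul_of_nonneg_left (add_le_add ?_ ?_) hε0
        · exact mul_le_of_le_one_left (by positivity) hε.2
        · gcongr

theorem norm_sub_carrierProj_add_norm_lt (h : IsClassicalSolution Q κ ω ε τ p u₁ u₃)
    (hS : MeasurableEigendecomposition Q K lam psi) (hε : ε ∈ Ioc 0 1) (hK : 0 ≤ K) (hG0 : 0 ≤ G)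
    (hG : ∀ j ∈ ({1, 3} : Set ℕ), ∀ ℓ, ‖(lamZero κ ω lam j)⁻¹ ℓ‖ ≤ G)
    (hC : ∀ j, ‖Q.nonlinForm (d := d) j‖ ≤ C) (hℓ₁ : lamJ κ ω lam 1 ℓ₁ 0 = 0)
    (hker : Module.finrank ℂ (LinearMap.ker (Matrix.toEuclideanLin (Q.L ω κ))) = 1)
    (hL₃ : IsUnit (Q.L (3 * ω) ((3 : ℝ) • κ))) (hp : Wiener.MemW1 p)
    (hpol : ∀ x, Wiener.eval p x ∈ LinearMap.ker (Matrix.toEuclideanLin (Q.L ω κ)))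
    (hT : T ∈ Icc 0 τ) (hσ : ε * T ≤ σ)
    (hB : ∀ t ∈ Icc 0 T, Wiener.normW1 (u₁ t) + Wiener.normW1 (u₃ t) ≤ B)
    (hY0 : 0 ≤ Y) (hY : 2 * G * K * Wiener.normW1 p
      + 2 * (2 * G * C * B ^ 3 + 3 * C * B ^ 2 * (Y + G * (2 * K * B + C * B ^ 3)) * σ) < Y) :
    ∀ t ∈ Icc 0 T, ‖u₁ t - hS.carrierProj κ ε ℓ₁ (u₁ t)‖ + ‖u₃ t‖ < ε * Y := by
  have hε0 := hε.1
  have hu₁ := h.isTransport₁ hε0.ne'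
  have hu₃ := h.isTransport₃ hε0.ne'
  have hp₁ : ‖u₁ 0 - hS.carrierProj κ ε ℓ₁ (u₁ 0)‖ ≤ ε * (2 * G * K * Wiener.normW1 p) := by
    rw [h.init₁, ← hS.nonresonant_one_eq hker hℓ₁]
    exact hS.norm_nonresonant_le_of_ae_mem_ker hε0 hK hG0 (hG 1 (by simp)) hp
      (by simpa using Wiener.ae_mem_ker hpol)
  have hp₃ : ‖u₃ 0‖ = 0 := by rw [h.init₃, norm_zero]
  have hmul₃ : ∀ f, hS.mul κ ε 3 (lamZero κ ω lam 3 * (lamZero κ ω lam 3)⁻¹) f = f := fun f => by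
    rw [hS.lamZero_mul_inv_eq_one (by simpa using hL₃), hS.mul_one_apply]
  have hcont := (hu₁.continuousOn.sub
    ((hS.carrierProj κ ε ℓ₁).continuous.comp_continuousOn hu₁.continuousOn)).norm.add
      hu₃.continuousOn.norm
  refine lt_of_bootstrap (hcont.mono (Icc_subset_Icc_right hT.2)) ?_ fun t ht hYt => ?_
  · have hC0 : 0 ≤ C := (norm_nonneg _).trans (hC 1)
    have : 0 ≤ B := (norm_nonneg _).trans (Wiener.norm_prod_le (hB 0 ⟨le_rfl, hT.1⟩))
    have hσ0 : 0 ≤ σ := (mul_nonneg hε0.le hT.1).trans hσ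
    rw [hp₃, add_zero]
    refine hp₁.trans_lt (mul_lt_mul_of_pos_left (lt_of_le_of_lt ?_ hY) hε0)
    exact le_add_of_nonneg_right (by positivity)
  · have htτ : t ∈ Icc 0 τ := ⟨ht.1, ht.2.trans hT.2⟩
    have htσ : ε * t ≤ σ := (mul_le_mul_of_nonneg_left ht.2 hε0.le).trans hσ
    have hBt := fun s (hs : s ∈ Icc 0 t) => hB s ⟨hs.1, hs.2.trans ht.2⟩
    have h₁ := h.norm_nonresonant_mode_le_mul hS hε hK hG0 hC hℓ₁ htτ htσ hY0 hBt hYt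
      (hG 1 (by simp)) (by simpa using hu₁)
    have h₃ := h.norm_nonresonant_mode_le_mul hS hε hK hG0 hC hℓ₁ htτ htσ hY0 hBt hYt
      (hG 3 (by simp)) (by simpa using hu₃)
    rw [hS.nonresonant_one_eq hker hℓ₁, hS.nonresonant_one_eq hker hℓ₁] at h₁
    rw [hmul₃, hmul₃] at h₃
    have := mul_lt_mul_of_pos_left hY hε0
    linarith

end Remainder

end IsClassicalSolution

/-! ### The transformed variables -/

section Transformed

variable {d n : ℕ} {lam : Fin n → Rd d → ℝ} {psi : Fin n → Rd d → Cn n} {κ : Rd d} {ω ε : ℝ}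
  {j : ℕ}

theorem toEuclideanLin_SJ_apply (t : ℝ) (k : Rd d) (v : Cn n) (ℓ : Fin n) :
    Matrix.toEuclideanLin (SJ κ ω lam psi j ε t k) v ℓ
      = exp ((t / ε * lamJ κ ω lam j ℓ (ε • k) : ℝ) * I)
        * inner ℂ (psi ℓ ((j : ℝ) • κ + ε • k)) v := by
  have h : Matrix.toEuclideanLin (SJ κ ω lam psi j ε t k) v ℓ
      = ∑ m, SJ κ ω lam psi j ε t k ℓ m * v m := rfl
  rw [h, PiLp.inner_apply, Finset.mul_sum]
  refine Finset.sum_congr rfl fun m _ => ?_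
  simp only [SJ, Matrix.diagonal_mul, Matrix.conjTranspose_apply, PsiJ, Matrix.of_apply,
    RCLike.inner_apply, RCLike.star_def]
  ring_nf

theorem norm_toEuclideanLin_SJ (hpsi : ∀ β, Orthonormal ℂ fun ℓ => psi ℓ β) (t : ℝ) (k : Rd d)
    (v : Cn n) : ‖Matrix.toEuclideanLin (SJ κ ω lam psi j ε t k) v‖ = ‖v‖ := by
  have hv := hpsi ((j : ℝ) • κ + ε • k)
  rw [← sq_eq_sq₀ (norm_nonneg _) (norm_nonneg _), EuclideanSpace.norm_sq_eq]
  conv_rhs => rw [← spectralMap_one hv finrank_euclideanSpace.symm v, norm_sq_spectralMap hv]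
  refine Finset.sum_congr rfl fun ℓ _ => ?_
  rw [toEuclideanLin_SJ_apply, norm_mul, norm_exp_ofReal_mul_I, one_mul, Pi.one_apply, one_mul]

theorem norm_zJ (hpsi : ∀ β, Orthonormal ℂ fun ℓ => psi ℓ β) (t : ℝ) (w : Wiener d n)
    (k : Rd d) : ‖zJ κ ω lam psi j ε t w k‖ = ‖w k‖ :=
  norm_toEuclideanLin_SJ hpsi t k (w k)

theorem coordProj_zJ (hpsi : ∀ β, Orthonormal ℂ fun ℓ => psi ℓ β) (t : ℝ) (ℓ₁ : Fin n)
    (w : Wiener d n) (k : Rd d) : coordProj ℓ₁ (zJ κ ω lam psi 1 ε t w k)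
      = Matrix.toEuclideanLin (SJ κ ω lam psi 1 ε t k) (eigProj κ psi ℓ₁ ε w k) := by
  ext ℓ
  rw [toEuclideanLin_SJ_apply, eigProj, Nat.cast_one, one_smul, inner_smul_right,
    orthonormal_iff_ite.1 (hpsi _), coordProj, PiLp.single_apply, zJ,
    toEuclideanLin_SJ_apply, Nat.cast_one, one_smul]
  split_ifs with h
  · rw [h, mul_one]
  · rw [mul_zero, mul_zero]

theorem norm_zJ_sub_coordProj (hpsi : ∀ β, Orthonormal ℂ fun ℓ => psi ℓ β) (t : ℝ)
    (ℓ₁ : Fin n) (w : Wiener d n) (k : Rd d) :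
    ‖zJ κ ω lam psi 1 ε t w k - coordProj ℓ₁ (zJ κ ω lam psi 1 ε t w k)‖
      = ‖w k - eigProj κ psi ℓ₁ ε w k‖ := by
  rw [coordProj_zJ hpsi, zJ, ← map_sub, norm_toEuclideanLin_SJ hpsi]

theorem norm_coordProj_le (ℓ₁ : Fin n) (v : Cn n) : ‖coordProj ℓ₁ v‖ ≤ ‖v‖ :=
  (PiLp.norm_single ..).trans_le (PiLp.norm_apply_le v ℓ₁)

variable {Q : HypSystem d n} {K : ℝ}

namespace MeasurableEigendecomposition

theorem eLpNorm_sub_eigProj (hS : MeasurableEigendecomposition Q K lam psi) (κ : Rd d) (ε : ℝ)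
    (ℓ₁ : Fin n) (f : Wiener d n) : eLpNorm (fun k => f k - eigProj κ psi ℓ₁ ε f k) 1 volume
      = ENNReal.ofReal ‖f - hS.carrierProj κ ε ℓ₁ f‖ := by
  rw [ofReal_norm, Lp.enorm_def]
  refine eLpNorm_congr_ae ?_
  filter_upwards [hS.coeFn_carrierProj κ ε ℓ₁ f, Lp.coeFn_sub f (hS.carrierProj κ ε ℓ₁ f)]
    with k h1 h2
  rw [h2, Pi.sub_apply, h1]

theorem scaledNorm_le (hS : MeasurableEigendecomposition Q K lam psi) (κ : Rd d) (ω : ℝ)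
    (hε : 0 ≤ ε) (t : ℝ) (ℓ₁ : Fin n) (f g : Wiener d n) :
    scaledNorm ℓ₁ ε (zJ κ ω lam psi 1 ε t f) (zJ κ ω lam psi 3 ε t g)
      ≤ ENNReal.ofReal (2 * ‖f‖ + 2 / ε * (‖f - hS.carrierProj κ ε ℓ₁ f‖ + ‖g‖)) := by
  have hP : eLpNorm (fun k => coordProj ℓ₁ (zJ κ ω lam psi 1 ε t f k)) 1 volume
      ≤ ENNReal.ofReal ‖f‖ := by
    rw [ofReal_norm, Lp.enorm_def]
    exact eLpNorm_mono fun k =>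
      (norm_coordProj_le ℓ₁ _).trans_eq (norm_zJ hS.orthonormal t f k)
  have hQ : eLpNorm (fun k => zJ κ ω lam psi 1 ε t f k - coordProj ℓ₁ (zJ κ ω lam psi 1 ε t f k))
      1 volume = ENNReal.ofReal ‖f - hS.carrierProj κ ε ℓ₁ f‖ := by
    rw [← hS.eLpNorm_sub_eigProj]
    exact eLpNorm_congr_norm_ae (.of_forall (norm_zJ_sub_coordProj hS.orthonormal t ℓ₁ f))
  have hz₃ : eLpNorm (zJ κ ω lam psi 3 ε t g) 1 volume = ENNReal.ofReal ‖g‖ := by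
    rw [ofReal_norm, Lp.enorm_def]
    exact eLpNorm_congr_norm_ae (.of_forall (norm_zJ hS.orthonormal t g))
  have hdiv : 0 ≤ 2 / ε := by positivity
  rw [scaledNorm, hQ, hz₃, add_assoc, ← mul_add, ← ENNReal.ofReal_add (norm_nonneg _)
    (norm_nonneg _), ← ENNReal.ofReal_mul hdiv, ENNReal.ofReal_add (by positivity) (by positivity),
    ENNReal.ofReal_mul zero_le_two, ENNReal.ofReal_ofNat]
  gcongr

theorem scaledNorm_le_and_norm_le (hS : MeasurableEigendecomposition Q K lam psi) (κ : Rd d) (ω : ℝ)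
    (hε : 0 < ε) (t : ℝ) {ℓ₁ : Fin n} {f g : Wiener d n} {B Y r : ℝ} (hf : ‖f‖ ≤ B)
    (hY : ‖f - hS.carrierProj κ ε ℓ₁ f‖ + ‖g‖ ≤ ε * Y) (hr : 2 * B + 2 * Y ≤ r) :
    scaledNorm ℓ₁ ε (zJ κ ω lam psi 1 ε t f) (zJ κ ω lam psi 3 ε t g) ≤ ENNReal.ofReal r ∧
      eLpNorm (fun k => f k - eigProj κ psi ℓ₁ ε f k) 1 volume ≤ ENNReal.ofReal (r / 2 * ε) ∧
      ‖g‖ ≤ r / 2 * ε := by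
  have hYr : ε * Y ≤ r / 2 * ε := by
    rw [mul_comm ε]
    exact mul_le_mul_of_nonneg_right (by linarith [norm_nonneg f]) hε.le
  have hPf := norm_nonneg (f - hS.carrierProj κ ε ℓ₁ f)
  have hg := norm_nonneg g
  refine ⟨(hS.scaledNorm_le κ ω hε.le t ℓ₁ f g).trans (ENNReal.ofReal_le_ofReal ?_), ?_,
    by linarith⟩
  · have : 2 / ε * (‖f - hS.carrierProj κ ε ℓ₁ f‖ + ‖g‖) ≤ 2 * Y := by
      rw [div_mul_eq_mul_div, div_le_iff₀ hε]
      linarith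
    linarith
  · rw [hS.eLpNorm_sub_eigProj]
    exact ENNReal.ofReal_le_ofReal (by linarith)

end MeasurableEigendecomposition

end Transformed

theorem proposition1_general (d n : ℕ) (tend M CT K G : ℝ) (htend : 0 < tend) :
    ∃ C : ℝ, ∀ r : ℝ, C < r → ∃ tstar ∈ Set.Ioc 0 tend,
      ∀ (Q : HypSystem d n) (κ : Rd d) (ω : ℝ) (p : Wiener d n)
        (lam : Fin n → Rd d → ℝ) (psi : Fin n → Rd d → Cn n) (ℓ₁ : Fin n),
        (∀ a b c : Cn n, ‖Q.TC a b c‖ ≤ CT * ‖a‖ * ‖b‖ * ‖c‖) →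
        Wiener.MemW1 p → Wiener.normW1 p ≤ M →
        Module.finrank ℂ (LinearMap.ker (Matrix.toEuclideanLin (Q.L ω κ))) = 1 →
        (∀ x, Wiener.eval p x ∈ LinearMap.ker (Matrix.toEuclideanLin (Q.L ω κ))) →
        IsUnit (Q.L (3 * ω) ((3 : ℝ) • κ)) →
        MeasurableEigendecomposition Q K lam psi →
        lamJ κ ω lam 1 ℓ₁ 0 = 0 →
        (∀ j ∈ ({1, 3} : Set ℕ), ∀ ℓ, lamJ κ ω lam j ℓ 0 ≠ 0 → |lamJ κ ω lam j ℓ 0|⁻¹ ≤ G) →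
        ∀ ε ∈ Set.Ioc (0 : ℝ) 1, ∀ u₁ u₃ : ℝ → Wiener d n,
          IsClassicalSolution Q κ ω ε (tend / ε) p u₁ u₃ →
          ∀ t ∈ Set.Icc 0 (tstar / ε),
            scaledNorm ℓ₁ ε (zJ κ ω lam psi 1 ε t (u₁ t)) (zJ κ ω lam psi 3 ε t (u₃ t))
                ≤ ENNReal.ofReal r ∧
            eLpNorm (fun k => u₁ t k - eigProj κ psi ℓ₁ ε (u₁ t) k) 1 volume
                ≤ ENNReal.ofReal (r / 2 * ε) ∧
            ‖u₃ t‖ ≤ r / 2 * ε := by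
  let C := 64 * (Wiener.evalConst d ^ 2 * |CT|)
  let B := |M| + 1
  let Y := 2 * |G| * |K| * |M| + 4 * |G| * C * B ^ 3 + 1
  have hB0 : 0 ≤ B := by positivity
  have hY0 : 0 ≤ Y := by positivity
  obtain ⟨σ, hσ, hB, hY⟩ := exists_mem_Ioc_add_mul_lt (b := 2 * ((3 * d + 1) * C * B ^ 3))
    (b' := 6 * C * B ^ 2 * (Y + |G| * (2 * |K| * B + C * B ^ 3))) htend (lt_add_one |M|)
    (lt_add_one (2 * |G| * |K| * |M| + 4 * |G| * C * B ^ 3))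
  refine ⟨2 * B + 2 * Y, fun r hr => ⟨σ, hσ, ?_⟩⟩
  intro Q κ ω p lam psi ℓ₁ hTC hp hpM hker hpol hL₃ hS' hℓ₁ hG ε hε u₁ u₃ hsol t ht
  have hS := hS'.mono (le_abs_self K)
  have hC : ∀ j, ‖Q.nonlinForm (d := d) j‖ ≤ C := Q.norm_nonlinForm_le (abs_nonneg CT)
    fun a b c => (hTC a b c).trans (by gcongr; exact le_abs_self CT)
  have hM : Wiener.normW1 p ≤ |M| := hpM.trans (le_abs_self M)
  have hpY : 2 * |G| * |K| * Wiener.normW1 p ≤ 2 * |G| * |K| * |M| := by gcongr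
  have hT : σ / ε ∈ Icc 0 (tend / ε) :=
    ⟨div_nonneg hσ.1.le hε.1.le, div_le_div_of_nonneg_right hσ.2 hε.1.le⟩
  have hεT : ε * (σ / ε) = σ := mul_div_cancel₀ σ hε.1.ne'
  have hX := hsol.normW1_lt hε.1 hB0 hC hT (by rw [hεT]; linarith)
  have hE := hsol.norm_sub_carrierProj_add_norm_lt hS hε (abs_nonneg K) (abs_nonneg G)
    (fun j hj ℓ => norm_lamZero_inv_le (hG j hj ℓ)) hC hℓ₁ hker hL₃ hp hpol hT hεT.le
    (fun s hs => (hX s hs).le) hY0 (by linarith)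
  exact hS.scaledNorm_le_and_norm_le κ ω hε.1 t ((norm_fst_le _).trans
    (Wiener.norm_prod_le (hX t ht).le)) (hE t ht).le hr.le

/-- `M` bounds `‖p‖_{W¹}`, `CT` is the constant in `|T(a,b,c)| ≤ CT |a| |b| |c|`, `K` is the Lipschitz
constant of the eigenvalues, and `G` bounds the inverses of the nonzero eigenvalues of `L₁(0)` and
`L₃(0)`. The threshold for `r` and `tstar` depend on nothing else, besides `d`, `n` and `tend`. -/
theorem proposition1 (d n : ℕ) (tend M CT K G : ℝ) (htend : 0 < tend) :
    ∃ C : ℝ, ∀ r : ℝ, C < r → ∃ tstar ∈ Set.Ioc 0 tend,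
      ∀ (Q : HypSystem d n) (κ : Rd d) (ω : ℝ) (p : Wiener d n)
        (lam : Fin n → Rd d → ℝ) (psi : Fin n → Rd d → Cn n) (ℓ₁ : Fin n),
        κ ≠ 0 →
        (∀ a b c : Cn n, ‖Q.TC a b c‖ ≤ CT * ‖a‖ * ‖b‖ * ‖c‖) →
        Wiener.MemW1 p → Wiener.normW1 p ≤ M →
        PolarizationAssumption Q κ ω p →
        SmoothEigendecomposition Q K lam psi →
        lamJ κ ω lam 1 ℓ₁ 0 = 0 →
        (∀ j ∈ ({1, 3} : Set ℕ), ∀ ℓ, lamJ κ ω lam j ℓ 0 ≠ 0 → |lamJ κ ω lam j ℓ 0|⁻¹ ≤ G) →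
        ∀ ε ∈ Set.Ioc (0 : ℝ) 1, ∀ u₁ u₃ : ℝ → Wiener d n,
          IsClassicalSolution Q κ ω ε (tend / ε) p u₁ u₃ →
          ∀ t ∈ Set.Icc 0 (tstar / ε),
            scaledNorm ℓ₁ ε (zJ κ ω lam psi 1 ε t (u₁ t)) (zJ κ ω lam psi 3 ε t (u₃ t))
                ≤ ENNReal.ofReal r ∧
            eLpNorm (fun k => u₁ t k - eigProj κ psi ℓ₁ ε (u₁ t) k) 1 volume
                ≤ ENNReal.ofReal (r / 2 * ε) ∧
            ‖u₃ t‖ ≤ r / 2 * ε := by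
  obtain ⟨C, hC⟩ := proposition1_general d n tend M CT K G htend
  refine ⟨C, fun r hr => (hC r hr).imp fun _ htstar => ⟨htstar.1, ?_⟩⟩
  intro Q κ ω p lam psi ℓ₁ _ hTC hp hpM hpol hS hℓ₁
  exact htstar.2 Q κ ω p lam psi ℓ₁ hTC hp hpM hpol.ker_dim hpol.polarized hpol.invertible₃
    hS.measurableEigendecomposition hℓ₁
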